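/- Fix an integer $d\ge 4$. For a field $K\in\{\mathbb R,\mathbb C\}$ let $K[x,y]_d$ be the space of binary forms of degree $d$ over $K$, and let $\mathbb P K[x,y]_d$ be its projectivization; regard $\mathbb P\,\mathbb R[x,y]_d\subseteq\mathbb P\,\mathbb C[x,y]_d$. For $F\in K[x,y]_d$ let $\operatorname{rk}_K(F)$ be the least $r$ such that $F=a_1L_1^d+\dots+a_rL_r^d$ with $a_i\in K$ and $L_i\in K[x,y]_1$ (this depends only on the class of $F$ up to nonzero scalars); write $\operatorname{rk}=\operatorname{rk}_{\mathbb C}$. A form $F\in\mathbb R[x,y]_d$ is called hyperbolic if it splits into linear factors over $\mathbb R$. Let $\Theta\subset\mathbb C$ be the set of $d$-th roots of unity. For a triple $\mathscr L=(L_1,L_2,L_3)$ of pairwise distinct points of $\mathbb P\,\mathbb C[x,y]_1$ and a triple $\xi=(\xi_1,\xi_2,\xi_3)$ of pairwise distinct elements of $\Theta$, let $\varphi\in\mathrm{PGL}_2(\mathbb C)$ be the unique element with $\varphi([x-\xi_ky])=L_k$ for $k=1,2,3$, and put $\Gamma_{\mathscr L}(\xi)=\varphi\cdot[x^d-y^d]\in\mathbb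 P\,\mathbb C[x,y]_d$, where $\mathrm{PGL}_2(\mathbb C)$ acts by linear changes of coordinates. Let $A\subseteq\mathbb P\,\mathbb R[x,y]_d$ be the set of all $F$ for which the gap $\operatorname{rk}_{\mathbb R}(F)-\operatorname{rk}(F)$ is maximal among all elements of $\mathbb P\,\mathbb R[x,y]_d$. Then: 1. the maximal value of the gap is $d-2$, and it is attained; 2. $A=\bigcup_{\mathscr L}\operatorname{im}\Gamma_{\mathscr L}$, the union over all triples $\mathscr L$ of pairwise distinct points of $\mathbb P\,\mathbb R[x,y]_1$ (an equality of subsets of $\mathbb P\,\mathbb C[x,y]_d$); 3. $A=\{F\in\mathbb P\,\mathbb R[x,y]_d : \operatorname{rk}(F)=2\text{ and }F\text{ is hyperbolic}\}$. -/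

import Mathlib

open MvPolynomial
open scoped LinearAlgebra.Projectivization MatrixGroups

noncomputable section

namespace BinaryForm

/-- `K[x,y]_d`, the space of binary forms of degree `d`; here `x = X 0` and `y = X 1`. -/
abbrev Form (K : Type*) [Field K] (d : ℕ) : Type _ :=
  ↥(homogeneousSubmodule (Fin 2) K d)

section Rank

variable {K : Type*} [Field K] {d : ℕ}

/-- `f` can be written as `a₁ L₁ ^ d + ⋯ + aᵣ Lᵣ ^ d` with scalars `aᵢ ∈ K` and linear
forms `Lᵢ ∈ K[x,y]_1`. -/
def HasWaringDecomposition (f : Form K d) (r : ℕ) : Prop :=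
  ∃ (a : Fin r → K) (L : Fin r → Form K 1),
    (f : MvPolynomial (Fin 2) K) = ∑ i, C (a i) * (L i : MvPolynomial (Fin 2) K) ^ d

/-- The Waring rank over `K` of a binary form. -/
def formRank (f : Form K d) : ℕ := sInf {r | HasWaringDecomposition f r}

/-- A binary form is hyperbolic if it splits into linear factors over `K` (`K = ℝ` below). -/
def FormHyperbolic (f : Form K d) : Prop :=
  ∃ (c : K) (L : Fin d → Form K 1),
    (f : MvPolynomial (Fin 2) K) = C c * ∏ i, (L i : MvPolynomial (Fin 2) K)

lemma HasWaringDecomposition.smul {f : Form K d} {r : ℕ} (h : HasWaringDecomposition f r)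
    (t : K) : HasWaringDecomposition (t • f) r := by
  obtain ⟨a, L, h⟩ := h
  refine ⟨fun i => t * a i, L, ?_⟩
  simp [h, MvPolynomial.smul_eq_C_mul, Finset.mul_sum, mul_assoc]

lemma FormHyperbolic.smul {f : Form K d} (h : FormHyperbolic f) (t : K) :
    FormHyperbolic (t • f) := by
  obtain ⟨c, L, h⟩ := h
  refine ⟨t * c, L, ?_⟩
  simp [h, MvPolynomial.smul_eq_C_mul, mul_assoc]

lemma iff_smul {P : Form K d → Prop} (hP : ∀ f, P f → ∀ t : K, P (t • f))
    (f g : { v : Form K d // v ≠ 0 }) (t : K) (h : (f : Form K d) = t • (g : Form K d)) :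
    P f ↔ P g := by
  have ht : t ≠ 0 := by
    rintro rfl
    exact f.2 (by simpa using h)
  refine ⟨fun hf => ?_, fun hg => h ▸ hP _ hg t⟩
  have := hP _ hf t⁻¹
  rwa [h, smul_smul, inv_mul_cancel₀ ht, one_smul] at this

/-- The Waring rank over `K` of a point of `ℙ K[x,y]_d`: the rank of any representative. -/
def waringRank (F : ℙ K (Form K d)) : ℕ :=
  Projectivization.lift (fun f => formRank (f : Form K d))
    (fun f g t h => by
      unfold formRank
      congr 1
      ext r
      exact iff_smul (P := fun f => HasWaringDecomposition f r) (fun _ hf t => hf.smul t) f g t h)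
    F

/-- Hyperbolicity of a point of `ℙ K[x,y]_d`: hyperbolicity of any representative. -/
def IsHyperbolic (F : ℙ K (Form K d)) : Prop :=
  Projectivization.lift (fun f => FormHyperbolic (f : Form K d))
    (fun f g t h => propext (iff_smul (fun _ hf t => hf.smul t) f g t h)) F

end Rank

section Complexification

/-- A real binary form regarded as a complex one. -/
def toComplex (d : ℕ) : Form ℝ d →ₛₗ[algebraMap ℝ ℂ] Form ℂ d where
  toFun f := ⟨MvPolynomial.map (algebraMap ℝ ℂ) f.1, f.2.map _⟩
  map_add' f g := by ext1; simp
  map_smul' t f := by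
    ext1
    change MvPolynomial.map (algebraMap ℝ ℂ) (t • f.1) =
      algebraMap ℝ ℂ t • MvPolynomial.map (algebraMap ℝ ℂ) f.1
    rw [MvPolynomial.smul_eq_C_mul, MvPolynomial.smul_eq_C_mul, map_mul, map_C]

lemma toComplex_injective (d : ℕ) : Function.Injective (toComplex d) := fun _ _ h =>
  Subtype.ext (MvPolynomial.map_injective _ (algebraMap ℝ ℂ).injective (congrArg Subtype.val h))

/-- The inclusion of `ℙ ℝ[x,y]_d` into `ℙ ℂ[x,y]_d`. -/
def complexify (d : ℕ) : ℙ ℝ (Form ℝ d) ↪ ℙ ℂ (Form ℂ d) where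
  toFun := Projectivization.map (toComplex d) (toComplex_injective d)
  inj' F G h := by
    induction F using Projectivization.ind with | h f hf =>
    induction G using Projectivization.ind with | h g hg =>
    rw [Projectivization.map_mk, Projectivization.map_mk, Projectivization.mk_eq_mk_iff'] at h
    obtain ⟨a, ha⟩ := h
    rw [Projectivization.mk_eq_mk_iff']
    refine ⟨a.re, Subtype.ext (MvPolynomial.ext _ _ fun m => ?_)⟩
    have := congrArg (fun p : Form ℂ d => (p.1.coeff m).re) ha
    simpa [toComplex, MvPolynomial.coeff_map] using this

/-- The gap between the real and the complex Waring rank. -/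
def rankGap {d : ℕ} (F : ℙ ℝ (Form ℝ d)) : ℤ :=
  (waringRank F : ℤ) - (waringRank (complexify d F) : ℤ)

/-- The set of real binary forms of degree `d` (up to scalars) with a maximal gap. -/
def maximalGapSet (d : ℕ) : Set (ℙ ℝ (Form ℝ d)) :=
  {F | ∀ G : ℙ ℝ (Form ℝ d), rankGap G ≤ rankGap F}

end Complexification

section Action

variable {K : Type*} [Field K] {d : ℕ}

/-- The linear change of coordinates given by a matrix `α`: the algebra map that acts on linear
forms by `α` in the basis `x, y`, so that `α · x = α₀₀ x + α₁₀ y`, `α · y = α₀₁ x + α₁₁ y`. -/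
def substitution (α : Matrix (Fin 2) (Fin 2) K) :
    MvPolynomial (Fin 2) K →ₐ[K] MvPolynomial (Fin 2) K :=
  aeval fun j => ∑ i, C (α i j) * X i

lemma substitution_X (α : Matrix (Fin 2) (Fin 2) K) (j : Fin 2) :
    substitution α (X j) = C (α 0 j) * X 0 + C (α 1 j) * X 1 := by
  simp [substitution, Fin.sum_univ_two]

lemma substitution_isHomogeneous (α : Matrix (Fin 2) (Fin 2) K)
    {f : MvPolynomial (Fin 2) K} (hf : f.IsHomogeneous d) :
    (substitution α f).IsHomogeneous d := by
  have := hf.aeval (n := 1) (fun j => ∑ i, C (α i j) * X i) fun j =>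
    IsHomogeneous.sum _ _ _ fun i _ => isHomogeneous_C_mul_X _ _
  rwa [one_mul] at this

lemma substitution_one : substitution (1 : Matrix (Fin 2) (Fin 2) K) = AlgHom.id K _ := by
  ext j : 1
  fin_cases j <;> simp [substitution_X]

lemma substitution_mul (α β : Matrix (Fin 2) (Fin 2) K) :
    substitution (α * β) = (substitution α).comp (substitution β) := by
  refine MvPolynomial.algHom_ext fun j => ?_
  have hC : ∀ a : K, substitution α (C a) = C a := fun a => (substitution α).commutes a
  rw [AlgHom.comp_apply, substitution_X, substitution_X, map_add, map_mul, map_mul, hC, hC,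
    substitution_X, substitution_X]
  simp only [Matrix.mul_apply, Fin.sum_univ_two, map_add, map_mul]
  ring

/-- The action of `GL₂` on `K[x,y]_d = Sym^d K[x,y]_1`. -/
instance formAction : DistribMulAction (GL (Fin 2) K) (Form K d) where
  smul α f := ⟨substitution α.1 f.1, substitution_isHomogeneous _ f.2⟩
  one_smul f := Subtype.ext (by
    change substitution (1 : Matrix (Fin 2) (Fin 2) K) f.1 = f.1
    simp [substitution_one])
  mul_smul α β f := Subtype.ext (by
    change substitution (α.1 * β.1) f.1 = substitution α.1 (substitution β.1 f.1)
    simp [substitution_mul])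
  smul_zero α := Subtype.ext (map_zero (substitution α.1))
  smul_add α f g := Subtype.ext (map_add (substitution α.1) f.1 g.1)

lemma coe_smul (α : GL (Fin 2) K) (f : Form K d) :
    ((α • f : Form K d) : MvPolynomial (Fin 2) K) = substitution α.1 f.1 := rfl

instance formAction_comm : SMulCommClass (GL (Fin 2) K) K (Form K d) where
  smul_comm α t f := Subtype.ext (map_smul (substitution α.1) t f.1)

lemma scalar_smul (u : Kˣ) (f : Form K d) :
    Matrix.GeneralLinearGroup.scalar (Fin 2) u • f = (u : K) ^ d • f := by
  ext1
  have h : ∀ j : Fin 2, substitution (Matrix.GeneralLinearGroup.scalar (Fin 2) u).1 (X j) =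
      C (u : K) * X j := by
    intro j
    rw [substitution_X]
    fin_cases j <;> simp [Matrix.GeneralLinearGroup.scalar]
  have h' : substitution (Matrix.GeneralLinearGroup.scalar (Fin 2) u).1 =
      aeval fun j => C (u : K) * X j := by
    refine MvPolynomial.algHom_ext fun j => ?_
    rw [h, aeval_X]
  rw [coe_smul, h']
  have hf : f.1.IsHomogeneous d := f.2
  change aeval (fun j => C (u : K) * X j) f.1 = (u : K) ^ d • f.1
  conv_lhs => rw [f.1.as_sum]
  conv_rhs => rw [f.1.as_sum]
  rw [map_sum, Finset.smul_sum]
  refine Finset.sum_congr rfl fun m hm => ?_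
  have hd : m 0 + m 1 = d := by
    have := hf (mem_support_iff.1 hm)
    rw [← this, Finsupp.weight_apply, Finsupp.sum_fintype _ _ (by simp)]
    simp [Fin.sum_univ_two]
  rw [aeval_monomial, MvPolynomial.smul_eq_C_mul, MvPolynomial.monomial_eq,
    Finsupp.prod_fintype _ _ (by simp), Finsupp.prod_fintype _ _ (by simp)]
  simp only [Fin.prod_univ_two, MvPolynomial.algebraMap_eq, mul_pow, map_pow]
  have hC : (C (u : K) : MvPolynomial (Fin 2) K) ^ d = C (u : K) ^ m 0 * C (u : K) ^ m 1 := by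
    rw [← pow_add, hd]
  rw [hC]
  ring

/-- The induced action of `PGL₂` on `ℙ K[x,y]_d`. -/
instance projAction : MulAction PGL(2, K) (ℙ K (Form K d)) :=
  Matrix.ProjGenLinGroup.mulActionOfGL fun u F => by
    induction F using Projectivization.ind with | h f hf =>
    rw [Projectivization.smul_mk, Projectivization.mk_eq_mk_iff']
    exact ⟨(u : K) ^ d, (scalar_smul u f).symm⟩

lemma mk_smul_mk (α : GL (Fin 2) K) (f : Form K d) (hf : f ≠ 0) :
    (Matrix.ProjGenLinGroup.mk α : PGL(2, K)) • Projectivization.mk K f hf =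
      Projectivization.mk K (α • f) ((smul_ne_zero_iff_ne α).2 hf) := rfl

/-- The linear form `v₀ x + v₁ y`. -/
def linearForm (v : Fin 2 → K) : Form K 1 :=
  ⟨C (v 0) * X 0 + C (v 1) * X 1,
    (isHomogeneous_C_mul_X _ _).add (isHomogeneous_C_mul_X _ _)⟩

lemma linearForm_injective : Function.Injective (linearForm (K := K)) := by
  intro v w h
  have h' := congrArg Subtype.val h
  have h0 := congrArg (MvPolynomial.eval ![1, 0]) h'
  have h1 := congrArg (MvPolynomial.eval ![0, 1]) h'
  simp only [linearForm, map_add, map_mul, eval_C, eval_X] at h0 h1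
  ext i
  fin_cases i
  · simpa using h0
  · simpa using h1

lemma linearForm_zero : linearForm (0 : Fin 2 → K) = 0 := by
  ext1
  simp [linearForm]

lemma linearForm_ne_zero {v : Fin 2 → K} (hv : v ≠ 0) : linearForm v ≠ 0 := fun h =>
  hv (linearForm_injective (h.trans linearForm_zero.symm))

lemma linearForm_smul (t : K) (v : Fin 2 → K) : linearForm (t • v) = t • linearForm v := by
  ext1
  simp [linearForm, MvPolynomial.smul_eq_C_mul]
  ring

lemma linearForm_surjective (f : Form K 1) : ∃ v, linearForm v = f := by
  obtain ⟨p, hf⟩ := f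
  rw [homogeneousSubmodule_one_eq_span_X, Submodule.mem_span_range_iff_exists_fun] at hf
  obtain ⟨c, hc⟩ := hf
  refine ⟨c, Subtype.ext ?_⟩
  change _ = p
  rw [← hc]
  simp [linearForm, MvPolynomial.smul_eq_C_mul, Fin.sum_univ_two]

lemma smul_linearForm (α : GL (Fin 2) K) (v : Fin 2 → K) :
    α • linearForm v = linearForm (α.1.mulVec v) := by
  ext1
  have hC : ∀ a : K, substitution α.1 (C a) = C a := fun a => (substitution α.1).commutes a
  rw [coe_smul]
  simp only [linearForm, map_add, map_mul, hC, substitution_X, Matrix.mulVec, dotProduct,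
    Fin.sum_univ_two]
  ring

/-- The point of `ℙ K[x,y]_1` given by `v₀ x + v₁ y`. -/
def linearPoint (v : Fin 2 → K) (hv : v ≠ 0) : ℙ K (Form K 1) :=
  Projectivization.mk K (linearForm v) (linearForm_ne_zero hv)

lemma linearPoint_surjective (p : ℙ K (Form K 1)) : ∃ v hv, linearPoint v hv = p := by
  induction p using Projectivization.ind with | h f hf =>
  obtain ⟨v, rfl⟩ := linearForm_surjective f
  exact ⟨v, fun h => hf (by rw [h, linearForm_zero]), rfl⟩

lemma linearPoint_eq_iff {v w : Fin 2 → K} (hv : v ≠ 0) (hw : w ≠ 0) :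
    linearPoint v hv = linearPoint w hw ↔ v 0 * w 1 - v 1 * w 0 = 0 := by
  rw [linearPoint, linearPoint, Projectivization.mk_eq_mk_iff']
  constructor
  · rintro ⟨a, ha⟩
    rw [← linearForm_smul] at ha
    rw [← linearForm_injective ha]
    simp only [Pi.smul_apply, smul_eq_mul]
    ring
  · intro h
    have hi : ∃ i, w i ≠ 0 := by
      by_contra! hcon
      exact hw (funext hcon)
    obtain ⟨i, hi⟩ := hi
    refine ⟨v i / w i, ?_⟩
    rw [← linearForm_smul]
    congr 1
    ext j
    rw [Pi.smul_apply, smul_eq_mul, div_mul_eq_mul_div, div_eq_iff hi]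
    fin_cases i <;> fin_cases j <;> simp only [Fin.zero_eta, Fin.mk_one, Fin.isValue]
    · linear_combination h
    · linear_combination -h

lemma mk_smul_linearPoint (α : GL (Fin 2) K) (v : Fin 2 → K) (hv : v ≠ 0)
    (hv' : α.1.mulVec v ≠ 0) :
    (Matrix.ProjGenLinGroup.mk α : PGL(2, K)) • linearPoint v hv =
      linearPoint (α.1.mulVec v) hv' := by
  rw [linearPoint, linearPoint, mk_smul_mk]
  congr 1
  exact smul_linearForm α v

lemma mulVec_ne_zero (α : GL (Fin 2) K) {v : Fin 2 → K} (hv : v ≠ 0) :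
    α.1.mulVec v ≠ 0 := by
  intro h
  apply hv
  have := congrArg (α⁻¹.1.mulVec) h
  rwa [Matrix.mulVec_mulVec, ← Units.val_mul, inv_mul_cancel, Units.val_one, Matrix.one_mulVec,
    Matrix.mulVec_zero] at this

/-- The coefficient vectors of `x`, `y`, `x + y`. -/
def standardVec : Fin 3 → Fin 2 → K := ![![1, 0], ![0, 1], ![1, 1]]

lemma standardVec_ne_zero (k : Fin 3) : standardVec (K := K) k ≠ 0 := by
  fin_cases k <;> simp [standardVec]

/-- The three points `[x]`, `[y]`, `[x + y]`. -/
def standardTriple (k : Fin 3) : ℙ K (Form K 1) :=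
  linearPoint (standardVec k) (standardVec_ne_zero k)

lemma exists_smul_standardTriple (M : Fin 3 ↪ ℙ K (Form K 1)) :
    ∃ φ : PGL(2, K), ∀ k, φ • standardTriple k = M k := by
  obtain ⟨u, hu, hMu⟩ := linearPoint_surjective (M 0)
  obtain ⟨v, hv, hMv⟩ := linearPoint_surjective (M 1)
  obtain ⟨w, hw, hMw⟩ := linearPoint_surjective (M 2)
  have huv : u 0 * v 1 - u 1 * v 0 ≠ 0 := by
    rw [Ne, ← linearPoint_eq_iff hu hv, hMu, hMv]
    exact M.injective.ne (by decide)
  have hwv : w 0 * v 1 - w 1 * v 0 ≠ 0 := by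
    rw [Ne, ← linearPoint_eq_iff hw hv, hMw, hMv]
    exact M.injective.ne (by decide)
  have huw : u 0 * w 1 - u 1 * w 0 ≠ 0 := by
    rw [Ne, ← linearPoint_eq_iff hu hw, hMu, hMw]
    exact M.injective.ne (by decide)
  let A : Matrix (Fin 2) (Fin 2) K :=
    !![(w 0 * v 1 - w 1 * v 0) * u 0, (u 0 * w 1 - u 1 * w 0) * v 0;
       (w 0 * v 1 - w 1 * v 0) * u 1, (u 0 * w 1 - u 1 * w 0) * v 1]
  have hA : A.det ≠ 0 := by
    have : A.det = (w 0 * v 1 - w 1 * v 0) * (u 0 * w 1 - u 1 * w 0) *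
        (u 0 * v 1 - u 1 * v 0) := by
      simp only [A, Matrix.det_fin_two_of]
      ring
    rw [this]
    exact mul_ne_zero (mul_ne_zero hwv huw) huv
  refine ⟨Matrix.ProjGenLinGroup.mk (Matrix.GeneralLinearGroup.mkOfDetNeZero A hA), fun k => ?_⟩
  rw [standardTriple, mk_smul_linearPoint _ _ _ (mulVec_ne_zero _ (standardVec_ne_zero k))]
  fin_cases k
  · refine Eq.trans ?_ hMu
    rw [linearPoint_eq_iff]
    simp [Matrix.GeneralLinearGroup.mkOfDetNeZero, A, Matrix.mulVec, dotProduct, standardVec]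
    ring
  · refine Eq.trans ?_ hMv
    rw [linearPoint_eq_iff]
    simp [Matrix.GeneralLinearGroup.mkOfDetNeZero, A, Matrix.mulVec, dotProduct, standardVec]
    ring
  · refine Eq.trans ?_ hMw
    rw [linearPoint_eq_iff]
    simp [Matrix.GeneralLinearGroup.mkOfDetNeZero, A, Matrix.mulVec, dotProduct, standardVec]
    ring

lemma eq_one_of_smul_standardTriple (φ : PGL(2, K))
    (h : ∀ k, φ • standardTriple (K := K) k = standardTriple k) : φ = 1 := by
  obtain ⟨α, rfl⟩ := Matrix.ProjGenLinGroup.mk_surjective φ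
  have key : ∀ k, (α.1.mulVec (standardVec k)) 0 * standardVec k 1 -
      (α.1.mulVec (standardVec k)) 1 * standardVec k 0 = 0 := by
    intro k
    have hk := h k
    rwa [standardTriple, mk_smul_linearPoint _ _ _ (mulVec_ne_zero _ (standardVec_ne_zero k)),
      linearPoint_eq_iff] at hk
  have h0 := key 0
  have h1 := key 1
  have h2 := key 2
  simp [Matrix.mulVec, dotProduct, standardVec] at h0 h1 h2
  rw [h0, h1] at h2
  have h3 : α.1 0 0 = α.1 1 1 := by linear_combination h2
  rw [Matrix.ProjGenLinGroup.mk_eq_one, Matrix.GeneralLinearGroup.center_eq_range_scalar]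
  have hne : α.1 0 0 ≠ 0 := by
    intro hz
    have hd : α.1.det ≠ 0 := (Matrix.isUnit_iff_isUnit_det _).1 α.isUnit |>.ne_zero
    apply hd
    rw [Matrix.det_fin_two, hz, h0]
    ring
  refine ⟨Units.mk0 _ hne, ?_⟩
  ext i j
  fin_cases i <;> fin_cases j <;> simp [Matrix.GeneralLinearGroup.scalar, h0, h1, h3]

/-- `PGL₂` acts simply transitively on triples of pairwise distinct points of `ℙ K[x,y]_1`. -/
theorem existsUnique_smul_triple (M L : Fin 3 ↪ ℙ K (Form K 1)) :
    ∃! φ : PGL(2, K), ∀ k, φ • M k = L k := by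
  obtain ⟨μ, hμ⟩ := exists_smul_standardTriple M
  obtain ⟨l, hl⟩ := exists_smul_standardTriple L
  refine ⟨l * μ⁻¹, fun k => ?_, fun φ hφ => ?_⟩
  · rw [mul_smul, ← hμ, inv_smul_smul, hl]
  · have : l⁻¹ * φ * μ = 1 := eq_one_of_smul_standardTriple _ fun k => by
      rw [mul_smul, mul_smul, hμ, hφ, ← hl, inv_smul_smul]
    rw [mul_assoc, inv_mul_eq_one] at this
    rw [eq_mul_inv_iff_mul_eq, this]

end Action

section Gamma

/-- The points `[x - ξ₁ y], [x - ξ₂ y], [x - ξ₃ y]` for pairwise distinct `d`-th roots of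
unity `ξ₁, ξ₂, ξ₃`. -/
def rootTriple {d : ℕ} (ξ : Fin 3 ↪ rootsOfUnity d ℂ) : Fin 3 ↪ ℙ ℂ (Form ℂ 1) where
  toFun k := linearPoint ![1, -((ξ k : ℂˣ) : ℂ)] (by simp)
  inj' k l h := by
    rw [linearPoint_eq_iff] at h
    refine ξ.injective (Subtype.ext (Units.ext ?_))
    simp at h
    linear_combination h

/-- The form `x ^ d - y ^ d`. -/
def powSub (d : ℕ) : Form ℂ d :=
  ⟨X 0 ^ d - X 1 ^ d, (isHomogeneous_X_pow _ _).sub (isHomogeneous_X_pow _ _)⟩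

lemma powSub_ne_zero {d : ℕ} (hd : d ≠ 0) : powSub d ≠ 0 := by
  intro h
  have := congrArg (fun p : Form ℂ d => MvPolynomial.eval ![1, 0] p.1) h
  simp [powSub, hd] at this

/-- The map `Γ_𝓛`, sending a triple `ξ` of pairwise distinct `d`-th roots of unity to
`φ · [x ^ d - y ^ d]`, where `φ ∈ PGL₂(ℂ)` is the unique element with
`φ · [x - ξ_k y] = L_k` for `k = 1, 2, 3`. -/
def Gamma (d : ℕ) (hd : d ≠ 0) (L : Fin 3 ↪ ℙ ℂ (Form ℂ 1))
    (ξ : Fin 3 ↪ rootsOfUnity d ℂ) : ℙ ℂ (Form ℂ d) :=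
  (existsUnique_smul_triple (rootTriple ξ) L).choose •
    Projectivization.mk ℂ (powSub d) (powSub_ne_zero hd)

end Gamma

end BinaryForm

end

/-! Everything reduces to one normal form: the gap of `f` equals `d - 2` exactly when `f = u ^ d + ū
^ d` over `ℂ` with `u` and `ū` independent (`IsConjPair`).

The main tool is apolarity. A form `g` of degree `d` pairs with `∑ aᵢ Lᵢ ^ d` to `∑ aᵢ g(Lᵢ)`, so a
product of linear forms vanishing at chosen points isolates one coefficient. Hence `u ^ d` is
independent of any `d` powers of forms not proportional to `u` (`eq_zero_of_add_sum_eq_zero`).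

Every real form has real rank at most `d` (`hasWaringDecomposition_real`): among the forms with `d`
equally spaced real roots, an intermediate value argument finds one apolar to `f`, and `f` is a
combination of the powers at its roots. Complex rank at least 3 therefore gives a gap of at most `d
- 3`, and complex rank 1 descends to `ℝ`. In complex rank 2 the two powers are unique, so
conjugation fixes both lines, giving real rank at most 2, or swaps them, giving a conjugate pair. By
independence a conjugate pair has real rank `d`.

With `ε ^ d = -1`, the form `u ^ d + ū ^ d` is the product of the `u - ζ ε ū` over `d`-th roots of
unity `ζ`, and each factor is proportional to a real form. A combination of two real powers instead
has a nonreal root. This gives the hyperbolic description.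

For `Γ`, the class `φ · [x ^ d - y ^ d]` is that of `u ^ d - v ^ d`, with `u, v` the columns of `φ`.
If `u - ξ v` is a real point for three values of `ξ` on the unit circle, then `v = t ū` with `|t| =
1` (`exists_eq_smul_conjVec`), and rescaling gives a conjugate pair. -/

namespace BinaryForm

/-! ### Apolarity and independence of powers of linear forms -/

section Apolarity

variable {K : Type*} [Field K] {d : ℕ}

/-- The determinant of the matrix with columns `v` and `w`. -/
def det2 (v w : Fin 2 → K) : K := v 0 * w 1 - v 1 * w 0

/-- The linear form `v₀ x + v₁ y` as a polynomial. -/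
noncomputable abbrev linearPoly (v : Fin 2 → K) : MvPolynomial (Fin 2) K := (linearForm v : Form K 1)

lemma linearPoly_eq_sum (v : Fin 2 → K) : linearPoly v = ∑ i, v i • X i := by
  simp [linearPoly, linearForm, Fin.sum_univ_two, MvPolynomial.smul_eq_C_mul]

lemma linearPoly_isHomogeneous (v : Fin 2 → K) : (linearPoly v).IsHomogeneous 1 :=
  (linearForm v).2

lemma linearPoly_pow_isHomogeneous (v : Fin 2 → K) (d : ℕ) :
    (linearPoly v ^ d).IsHomogeneous d := by
  simpa using (linearPoly_isHomogeneous v).pow d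

@[simp] lemma eval_linearPoly (r v : Fin 2 → K) :
    eval r (linearPoly v) = v 0 * r 0 + v 1 * r 1 := by
  simp [linearPoly, linearForm]

lemma linearPoly_smul (t : K) (v : Fin 2 → K) : linearPoly (t • v) = C t * linearPoly v := by
  simp only [linearPoly, linearForm_smul, ← MvPolynomial.smul_eq_C_mul]
  rfl

/-- Supplies a linear form whose zeros are the multiples of a nonzero `v`; the apolar forms below
are products of these. -/
lemma eval_linearPoly_rotate (r v : Fin 2 → K) :
    eval r (linearPoly ![-v 1, v 0]) = det2 v r := by
  simp [det2]
  ring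

lemma exists_eq_smul_of_det2_eq_zero {v w : Fin 2 → K} (hw : w ≠ 0) (h : det2 v w = 0) :
    ∃ t : K, v = t • w := by
  have hi : ∃ i, w i ≠ 0 := by
    by_contra! hcon
    exact hw (funext hcon)
  obtain ⟨i, hi⟩ := hi
  refine ⟨v i / w i, ?_⟩
  ext j
  rw [Pi.smul_apply, smul_eq_mul, div_mul_eq_mul_div, eq_div_iff hi]
  unfold det2 at h
  fin_cases i <;> fin_cases j <;> simp only [Fin.zero_eta, Fin.mk_one, Fin.isValue]
  · linear_combination -h
  · linear_combination h

/-- Evaluation at `v` is dual to the power `v ^ d`. -/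
theorem sum_eval_eq_zero [CharZero K] {ι : Type*} [Fintype ι] {a : ι → K} {v : ι → Fin 2 → K}
    (h : ∑ i, C (a i) * linearPoly (v i) ^ d = 0) {g : MvPolynomial (Fin 2) K}
    (hg : g.IsHomogeneous d) : ∑ i, a i * eval (v i) g = 0 := by
  -- The coefficient of the monomial `s` in the relation is a multinomial coefficient times this
  -- sum; characteristic zero allows cancelling it.
  have key : ∀ s ∈ g.support, ∑ i, a i * ∏ j, v i j ^ s j = 0 := by
    intro s hs
    have hs' : (s.sum fun _ m => m) = d := by
      have := hg (mem_support_iff.1 hs)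
      rwa [Finsupp.weight_apply, show (s.sum fun i c => c • (1 : Fin 2 → ℕ) i) =
        s.sum fun _ m => m by simp] at this
    have hc := congrArg (coeff s) h
    simp only [coeff_sum, coeff_C_mul, linearPoly_eq_sum,
      coeff_linearCombination_X_pow_of_fintype, hs', if_true, coeff_zero] at hc
    have hm : (s.multinomial : K) ≠ 0 := by
      rw [Finsupp.multinomial_eq]
      exact_mod_cast (Nat.multinomial_pos _ _).ne'
    apply (mul_eq_zero.1 _).resolve_left hm
    rw [Finset.mul_sum, ← hc]
    refine Finset.sum_congr rfl fun i _ => ?_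
    rw [Finsupp.prod_fintype _ _ (by simp)]
    ring
  simp_rw [eval_eq', Finset.mul_sum]
  rw [Finset.sum_comm]
  refine Finset.sum_eq_zero fun s hs => ?_
  rw [← mul_zero (coeff s g), ← key s hs, Finset.mul_sum]
  exact Finset.sum_congr rfl fun i _ => by ring

/-- Makes the pairing with `g` independent of the chosen decomposition. -/
lemma sum_eval_eq_of_sum_eq [CharZero K] {ι κ : Type*} [Fintype ι] [Fintype κ]
    {a : ι → K} {v : ι → Fin 2 → K} {b : κ → K} {w : κ → Fin 2 → K}
    (h : ∑ i, C (a i) * linearPoly (v i) ^ d = ∑ i, C (b i) * linearPoly (w i) ^ d)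
    {g : MvPolynomial (Fin 2) K} (hg : g.IsHomogeneous d) :
    ∑ i, a i * eval (v i) g = ∑ i, b i * eval (w i) g := by
  have := sum_eval_eq_zero (ι := ι ⊕ κ) (a := Sum.elim a (fun k => -b k)) (v := Sum.elim v w)
    (by simp [h]) hg
  simpa [← sub_eq_add_neg, sub_eq_zero] using this

/-- The power of a linear form is independent of at most `d` powers of other linear forms. -/
theorem eq_zero_of_add_sum_eq_zero [CharZero K] {ι : Type*} [Fintype ι] {c : K} {u : Fin 2 → K}
    {a : ι → K} {v : ι → Fin 2 → K}
    (h : C c * linearPoly u ^ d + ∑ i, C (a i) * linearPoly (v i) ^ d = 0)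
    (hd : Fintype.card ι ≤ d) (hu : u ≠ 0) (hv : ∀ i, v i ≠ 0 → det2 (v i) u ≠ 0) : c = 0 := by
  obtain ⟨l, hl⟩ : ∃ l : Fin 2 → K, eval u (linearPoly l) ≠ 0 := by
    by_contra! hcon
    refine hu (funext fun i => ?_)
    fin_cases i
    · simpa using hcon ![1, 0]
    · simpa using hcon ![0, 1]
  have hp : ∀ i, ∃ p : Fin 2 → K, eval (v i) (linearPoly p) = 0 ∧ eval u (linearPoly p) ≠ 0 := by
    intro i
    by_cases h0 : v i = 0
    -- Every linear form vanishes at the zero vector, so `l` itself serves.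
    · exact ⟨l, by rw [h0, eval_linearPoly]; simp, hl⟩
    · refine ⟨![-v i 1, v i 0], ?_, ?_⟩
      · rw [eval_linearPoly_rotate, det2]
        ring
      · rw [eval_linearPoly_rotate]
        exact hv i h0
  choose p hp0 hp1 using hp
  -- This test form vanishes at every `v i` but not at `u`; the power of `l` pads its degree to `d`.
  have hg : ((∏ i, linearPoly (p i)) * linearPoly l ^ (d - Fintype.card ι)).IsHomogeneous d := by
    have h1 := IsHomogeneous.prod Finset.univ (fun i => linearPoly (p i)) (fun _ => 1)
      fun i _ => linearPoly_isHomogeneous (p i)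
    have h2 := h1.mul (linearPoly_pow_isHomogeneous l (d - Fintype.card ι))
    simpa [hd] using h2
  have h' := sum_eval_eq_zero (ι := Option ι) (a := fun o => o.elim c a)
    (v := fun o => o.elim u v) (by simpa [Fintype.sum_option] using h) hg
  rw [Fintype.sum_option, Finset.sum_eq_zero, add_zero] at h'
  · refine (mul_eq_zero.1 h').resolve_right ?_
    simp only [Option.elim, map_mul, map_prod, map_pow]
    exact mul_ne_zero (Finset.prod_ne_zero_iff.2 fun i _ => hp1 i) (pow_ne_zero _ hl)
  · intro i _
    simp only [Option.elim, map_mul, map_prod]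
    rw [Finset.prod_eq_zero (Finset.mem_univ i) (hp0 i)]
    ring

end Apolarity

/-! ### Bases of powers of linear forms -/

section Spanning

variable {K : Type*} [Field K] {d : ℕ}

/-- The power of a linear form as a form. -/
noncomputable def linearPow (d : ℕ) (v : Fin 2 → K) : Form K d :=
  ⟨linearPoly v ^ d, linearPoly_pow_isHomogeneous v d⟩

lemma coe_sum_smul_linearPow {ι : Type*} [Fintype ι] (a : ι → K) (v : ι → Fin 2 → K) :
    ((∑ i, a i • linearPow d (v i) : Form K d) : MvPolynomial (Fin 2) K) =
      ∑ i, C (a i) * linearPoly (v i) ^ d := by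
  simp [linearPow, MvPolynomial.smul_eq_C_mul]

/-- The monomial `x ^ k * y ^ (d - k)` as a form of degree `d`. -/
noncomputable def monomialForm (K : Type*) [Field K] (d : ℕ) (k : Fin (d + 1)) : Form K d :=
  ⟨X 0 ^ (k : ℕ) * X 1 ^ (d - k), by
    simpa [Nat.add_sub_cancel' (Nat.lt_succ_iff.1 k.2)] using
      (isHomogeneous_X_pow (R := K) (0 : Fin 2) k).mul (isHomogeneous_X_pow 1 (d - k))⟩

lemma span_monomialForm : Submodule.span K (Set.range (monomialForm K d)) = ⊤ := by
  rw [eq_top_iff]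
  rintro ⟨f, hf⟩ -
  have hsum : (⟨f, hf⟩ : Form K d) = ∑ s ∈ f.support.attach, ⟨monomial s.1 (coeff s.1 f), by
      have := hf (mem_support_iff.1 s.2)
      rw [mem_homogeneousSubmodule]
      exact isHomogeneous_monomial _ (by rwa [Finsupp.degree_eq_weight_one])⟩ := by
    ext1
    simp only [AddSubmonoidClass.coe_finsetSum]
    rw [Finset.sum_attach f.support (fun s => monomial s (coeff s f)), ← as_sum]
  rw [hsum]
  refine Submodule.sum_mem _ fun s _ => ?_
  have hs : s.1 0 + s.1 1 = d := by
    have := hf (mem_support_iff.1 s.2)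
    rw [← this, Finsupp.weight_apply, Finsupp.sum_fintype _ _ (by simp)]
    simp [Fin.sum_univ_two]
  have hk : s.1 0 < d + 1 := by omega
  have hd : d - s.1 0 = s.1 1 := by omega
  have heq : (⟨monomial s.1 (coeff s.1 f), by
      have := hf (mem_support_iff.1 s.2)
      rw [mem_homogeneousSubmodule]
      exact isHomogeneous_monomial _ (by rwa [Finsupp.degree_eq_weight_one])⟩ : Form K d) =
      coeff s.1 f • monomialForm K d ⟨s.1 0, hk⟩ := by
    ext1
    simp only [monomialForm, hd, Submodule.coe_smul, MvPolynomial.smul_eq_C_mul]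
    rw [MvPolynomial.monomial_eq, Finsupp.prod_fintype _ _ (by simp), Fin.prod_univ_two]
  rw [heq]
  exact Submodule.smul_mem _ _ (Submodule.subset_span ⟨_, rfl⟩)

/-- The upper bound suffices: `d + 1` independent powers give the reverse inequality. -/
lemma finrank_form_le : Module.finrank K (Form K d) ≤ d + 1 := by
  have := finrank_range_le_card (R := K) (monomialForm K d)
  rwa [Set.finrank, span_monomialForm, finrank_top, Fintype.card_fin] at this

instance : Module.Finite K (Form K d) :=
  Module.Finite.iff_fg.2 (homogeneousSubmodule_fg (σ := Fin 2) K d)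

/-- Powers of `d + 1` pairwise independent linear forms span the forms of degree `d`. -/
theorem exists_eq_sum_pow [CharZero K] {ι : Type*} [Fintype ι] (hι : Fintype.card ι = d + 1)
    (v : ι → Fin 2 → K) (hv : Pairwise fun i j => det2 (v i) (v j) ≠ 0) (hv0 : ∀ i, v i ≠ 0)
    (f : Form K d) :
    ∃ a : ι → K, (f : MvPolynomial (Fin 2) K) = ∑ i, C (a i) * linearPoly (v i) ^ d := by
  classical
  have hli : LinearIndependent K fun i => linearPow d (v i) := by
    rw [Fintype.linearIndependent_iff]
    intro a ha i
    have h' := congrArg Subtype.val ha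
    rw [coe_sum_smul_linearPow, ← Finset.add_sum_erase _ _ (Finset.mem_univ i),
      Finset.sum_subtype (p := fun j => j ≠ i) _ (by simp)
        (fun j => C (a j) * linearPoly (v j) ^ d)] at h'
    refine eq_zero_of_add_sum_eq_zero h' ?_ (hv0 i) fun j _ => hv j.2
    rw [Fintype.card_subtype_compl, hι]
    simp
  have hspan := hli.span_eq_top_of_card_eq_finrank' (by
    have := hli.fintype_card_le_finrank
    have := finrank_form_le (K := K) (d := d)
    omega)
  have hf : f ∈ Submodule.span K (Set.range fun i => linearPow d (v i)) := hspan ▸ trivial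
  obtain ⟨a, ha⟩ := (Submodule.mem_span_range_iff_exists_fun K).1 hf
  exact ⟨a, by rw [← ha, coe_sum_smul_linearPow]⟩

end Spanning

/-! ### Real rank is at most the degree -/

section RealRank

variable {d : ℕ}

/-- The point of the unit circle of angle `(s + t π) / d`. -/
noncomputable def circleVec (d : ℕ) (s t : ℝ) : Fin 2 → ℝ :=
  ![Real.cos ((s + t * Real.pi) / d), Real.sin ((s + t * Real.pi) / d)]

lemma circleVec_ne_zero (s t : ℝ) : circleVec d s t ≠ 0 := by
  intro h
  have h0 := congrFun h 0
  have h1 := congrFun h 1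
  simp only [circleVec, Matrix.cons_val_zero, Matrix.cons_val_one, Pi.zero_apply] at h0 h1
  have := Real.sin_sq_add_cos_sq ((s + t * Real.pi) / d)
  rw [h0, h1] at this
  norm_num at this

lemma det2_circleVec (s t t' : ℝ) :
    det2 (circleVec d s t) (circleVec d s t') = Real.sin ((t' - t) * Real.pi / d) := by
  rw [show (t' - t) * Real.pi / d = (s + t' * Real.pi) / d - (s + t * Real.pi) / d by ring,
    Real.sin_sub]
  simp only [det2, circleVec, Matrix.cons_val_zero, Matrix.cons_val_one]
  ring

/-- The angles differ by less than `π`, and sine vanishes on `(-π, π)` only at 0. -/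
lemma det2_circleVec_ne_zero (s : ℝ) {t t' : ℝ} (hne : t ≠ t') (h : |t' - t| < d) :
    det2 (circleVec d s t) (circleVec d s t') ≠ 0 := by
  have hd : (0 : ℝ) < d := (abs_nonneg _).trans_lt h
  rw [det2_circleVec]
  obtain ⟨h1, h2⟩ := abs_lt.1 h
  have hpi := Real.pi_pos
  refine fun h0 => hne ?_
  rw [Real.sin_eq_zero_iff_of_lt_of_lt] at h0
  · have : (t' - t) * Real.pi = 0 := by
      rwa [div_eq_zero_iff, or_iff_left hd.ne'] at h0
    have := (mul_eq_zero.1 this).resolve_right hpi.ne'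
    linarith
  · rw [lt_div_iff₀ hd]
    nlinarith
  · rw [div_lt_iff₀ hd]
    nlinarith

/-- Any real form is a combination of the powers of the `d` linear forms of angles
`(s + j π) / d` and of one more. -/
lemma exists_eq_sum_circleVec (hd : 0 < d) (s : ℝ) (f : Form ℝ d) :
    ∃ (a : Fin d → ℝ) (b : ℝ), (f : MvPolynomial (Fin 2) ℝ) =
      ∑ j, C (a j) * linearPoly (circleVec d s j) ^ d +
        C b * linearPoly (circleVec d s (d - 1 / 2)) ^ d := by
  have hd1 : (1 : ℝ) ≤ d := by exact_mod_cast hd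
  have hj : ∀ j : Fin d, (0 : ℝ) ≤ j ∧ (j : ℝ) ≤ d - 1 := fun j => by
    have : ((j : ℕ) : ℝ) + 1 ≤ d := by exact_mod_cast j.2
    exact ⟨by positivity, by linarith⟩
  obtain ⟨a, ha⟩ := exists_eq_sum_pow (ι := Option (Fin d)) (by simp)
    -- The extra parameter `d - 1/2` lies beyond the last index `d - 1` but before `d`, where the
    -- line of index 0 recurs.
    (fun o => circleVec d s (o.elim ((d : ℝ) - 1 / 2) fun j => (j : ℝ)))
    (by
      intro o o' hne
      apply det2_circleVec_ne_zero
      · rcases o with _ | j <;> rcases o' with _ | j' <;> simp only [Option.elim]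
        · exact absurd rfl hne
        · have := hj j'
          intro h
          linarith
        · have := hj j
          intro h
          linarith
        · intro h
          exact hne (congrArg some (Fin.ext (by exact_mod_cast h)))
      · rw [abs_lt]
        rcases o with _ | j <;> rcases o' with _ | j' <;> simp only [Option.elim]
        · constructor <;> linarith
        · have := hj j'
          constructor <;> linarith
        · have := hj j
          constructor <;> linarith
        · have := hj j
          have := hj j'
          constructor <;> linarith)
    (fun _ => circleVec_ne_zero _ _) f
  refine ⟨fun j => a (some j), a none, ?_⟩
  rw [ha, Fintype.sum_option, add_comm]
  rfl

/-- The form of degree `d` vanishing at the points of angles `(s + j π) / d`. -/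
noncomputable def circlePoly (d : ℕ) (s : ℝ) : MvPolynomial (Fin 2) ℝ :=
  ∏ j ∈ Finset.range d, linearPoly ![-circleVec d s j 1, circleVec d s j 0]

lemma circlePoly_isHomogeneous (s : ℝ) : (circlePoly d s).IsHomogeneous d := by
  have := IsHomogeneous.prod (Finset.range d) _ (fun _ => 1)
    fun (j : ℕ) _ => linearPoly_isHomogeneous ![-circleVec d s j 1, circleVec d s j 0]
  simp only [Finset.sum_const, Finset.card_range, smul_eq_mul, mul_one] at this
  exact this

lemma eval_circlePoly (s : ℝ) (u : Fin 2 → ℝ) :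
    eval u (circlePoly d s) = ∏ j ∈ Finset.range d, det2 (circleVec d s j) u := by
  simp only [circlePoly, map_prod, eval_linearPoly_rotate]

/-- Adding `π` to `s` shifts each index by one; the new last point is the antipode of the old first
one, which produces a single sign. -/
lemma eval_circlePoly_pi (hd : 0 < d) (u : Fin 2 → ℝ) :
    eval u (circlePoly d Real.pi) = -eval u (circlePoly d 0) := by
  have hd' : (d : ℝ) ≠ 0 := by exact_mod_cast hd.ne'
  have hs : ∀ j : ℕ, circleVec d Real.pi j = circleVec d 0 ((j + 1 : ℕ) : ℝ) := by
    intro j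
    have : Real.pi + (j : ℝ) * Real.pi = 0 + ((j + 1 : ℕ) : ℝ) * Real.pi := by
      push_cast
      ring
    simp only [circleVec, this]
  have hl : det2 (circleVec d 0 (d : ℝ)) u = -det2 (circleVec d 0 ((0 : ℕ) : ℝ)) u := by
    have : (0 + (d : ℝ) * Real.pi) / d = Real.pi := by field_simp; ring
    simp only [circleVec, this, det2]
    simp
  rw [eval_circlePoly, eval_circlePoly]
  simp_rw [hs]
  obtain ⟨n, rfl⟩ := Nat.exists_eq_succ_of_ne_zero hd.ne'
  rw [Finset.prod_range_succ, Finset.prod_range_succ' (fun j : ℕ => det2 _ u)]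
  simp only [Nat.succ_eq_add_one] at hl ⊢
  rw [hl]
  ring

/-- Any real form of degree `d` is a combination of `d` powers of real linear forms. -/
theorem hasWaringDecomposition_real (hd : 0 < d) (f : Form ℝ d) : HasWaringDecomposition f d := by
  obtain ⟨a₀, b₀, h₀⟩ := exists_eq_sum_circleVec hd 0 f
  set w : Option (Fin d) → Fin 2 → ℝ :=
    fun o => o.elim (circleVec d 0 (d - 1 / 2)) fun j => circleVec d 0 j
  set c : Option (Fin d) → ℝ := fun o => o.elim b₀ a₀
  -- `Φ s` is the pairing of `f` with `circlePoly d s`, computed in one decomposition that does not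
  -- move with `s`.
  set Φ : ℝ → ℝ := fun s => ∑ o, c o * eval (w o) (circlePoly d s)
  have hcont : Continuous Φ := by
    simp only [Φ, eval_circlePoly, det2, circleVec, Matrix.cons_val_zero, Matrix.cons_val_one]
    fun_prop
  have hneg : Φ Real.pi = -Φ 0 := by
    simp only [Φ, eval_circlePoly_pi hd, mul_neg, Finset.sum_neg_distrib]
  obtain ⟨s, hs⟩ : ∃ s, Φ s = 0 := by
    rcases le_total (Φ 0) 0 with h | h
    · exact mem_range_of_exists_le_of_exists_ge hcont ⟨0, h⟩ ⟨Real.pi, by linarith⟩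
    · exact mem_range_of_exists_le_of_exists_ge hcont ⟨Real.pi, by linarith⟩ ⟨0, h⟩
  obtain ⟨a, b, h⟩ := exists_eq_sum_circleVec hd s f
  have hpair := sum_eval_eq_of_sum_eq (d := d) (a := c) (v := w)
    (b := fun o : Option (Fin d) => o.elim b a)
    (w := fun o => o.elim (circleVec d s (d - 1 / 2)) fun j => circleVec d s j)
    (by
      simp only [Fintype.sum_option, c, w, Option.elim]
      rw [add_comm, ← h₀, h, add_comm]) (circlePoly_isHomogeneous s)
  -- In the decomposition adapted to `s`, the `d` terms at the roots vanish, and the pairing is `b`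
  -- times a nonzero value.
  have hb : b = 0 := by
    change Φ s = _ at hpair
    rw [hs, Fintype.sum_option, Finset.sum_eq_zero, add_zero, eq_comm] at hpair
    · refine (mul_eq_zero.1 hpair).resolve_right ?_
      simp only [Option.elim, eval_circlePoly]
      refine Finset.prod_ne_zero_iff.2 fun j hj => ?_
      have h1 : (j : ℝ) + 1 ≤ d := by exact_mod_cast Finset.mem_range.1 hj
      have h2 : (0 : ℝ) ≤ j := by positivity
      refine det2_circleVec_ne_zero s (by intro h; linarith) ?_
      rw [abs_lt]
      constructor <;> linarith
    · intro j _
      simp only [Option.elim, eval_circlePoly]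
      rw [Finset.prod_eq_zero (Finset.mem_range.2 j.2), mul_zero]
      rw [det2]
      ring
  refine ⟨a, fun j => linearForm (circleVec d s j), ?_⟩
  rw [h, hb]
  simp

end RealRank

/-! ### Complex conjugation and real structure -/

section Conjugation

variable {d : ℕ}

/-- The complex conjugate of a vector. -/
def conjVec (u : Fin 2 → ℂ) : Fin 2 → ℂ := fun i => starRingEnd ℂ (u i)

/-- A real vector regarded as a complex one. -/
def ofRealVec (p : Fin 2 → ℝ) : Fin 2 → ℂ := fun i => (p i : ℂ)

lemma map_linearPoly {K L : Type*} [Field K] [Field L] (φ : K →+* L) (v : Fin 2 → K) :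
    MvPolynomial.map φ (linearPoly v) = linearPoly fun i => φ (v i) := by
  simp [linearPoly, linearForm]

lemma map_conj_linearPoly (u : Fin 2 → ℂ) :
    MvPolynomial.map (starRingEnd ℂ) (linearPoly u) = linearPoly (conjVec u) :=
  map_linearPoly _ _

lemma map_ofReal_linearPoly (p : Fin 2 → ℝ) :
    MvPolynomial.map (algebraMap ℝ ℂ) (linearPoly p) = linearPoly (ofRealVec p) :=
  map_linearPoly _ _

@[simp] lemma conjVec_conjVec (u : Fin 2 → ℂ) : conjVec (conjVec u) = u := by
  ext i
  simp [conjVec]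

lemma conjVec_smul (t : ℂ) (u : Fin 2 → ℂ) :
    conjVec (t • u) = starRingEnd ℂ t • conjVec u := by
  ext i
  simp [conjVec]

lemma det2_comm {K : Type*} [Field K] (v w : Fin 2 → K) : det2 v w = -det2 w v := by
  simp only [det2]
  ring

lemma det2_smul_left {K : Type*} [Field K] (t : K) (v w : Fin 2 → K) :
    det2 (t • v) w = t * det2 v w := by
  simp only [det2, Pi.smul_apply, smul_eq_mul]
  ring

lemma det2_smul_right {K : Type*} [Field K] (t : K) (v w : Fin 2 → K) :
    det2 v (t • w) = t * det2 v w := by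
  simp only [det2, Pi.smul_apply, smul_eq_mul]
  ring

@[simp] lemma det2_self {K : Type*} [Field K] (v : Fin 2 → K) : det2 v v = 0 := by
  simp only [det2]
  ring

lemma ne_zero_of_det2_left {K : Type*} [Field K] {v w : Fin 2 → K} (h : det2 v w ≠ 0) :
    v ≠ 0 := by
  rintro rfl
  simp [det2] at h

lemma ne_zero_of_det2_right {K : Type*} [Field K] {v w : Fin 2 → K} (h : det2 v w ≠ 0) :
    w ≠ 0 := by
  rintro rfl
  simp [det2] at h

/-- A nonzero vector is not proportional to two independent vectors. -/
lemma det2_ne_zero_of_det2_eq_zero {K : Type*} [Field K] {u v w : Fin 2 → K}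
    (h : det2 u v ≠ 0) (hw : w ≠ 0) (h0 : det2 w u = 0) : det2 w v ≠ 0 := by
  obtain ⟨t, rfl⟩ := exists_eq_smul_of_det2_eq_zero (ne_zero_of_det2_left h) h0
  rw [det2_smul_left]
  refine mul_ne_zero ?_ h
  rintro rfl
  simp at hw

lemma det2_conjVec (u v : Fin 2 → ℂ) :
    det2 (conjVec u) (conjVec v) = starRingEnd ℂ (det2 u v) := by
  simp [det2, conjVec]

lemma conjVec_ofRealVec (p : Fin 2 → ℝ) : conjVec (ofRealVec p) = ofRealVec p := by
  ext i
  simp [conjVec, ofRealVec]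

lemma det2_ofRealVec (p q : Fin 2 → ℝ) :
    det2 (ofRealVec p) (ofRealVec q) = ((det2 p q : ℝ) : ℂ) := by
  simp [det2, ofRealVec]

/-- A complex vector proportional to its conjugate is proportional to a real vector. -/
lemma exists_eq_smul_ofRealVec {u : Fin 2 → ℂ} (h : det2 u (conjVec u) = 0) :
    ∃ (κ : ℂ) (p : Fin 2 → ℝ), u = κ • ofRealVec p := by
  by_cases hu : u = 0
  · exact ⟨0, 0, by simp [hu]⟩
  have hi : ∃ i, u i ≠ 0 := by
    by_contra! hcon
    exact hu (funext hcon)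
  obtain ⟨i, hi⟩ := hi
  refine ⟨u i, fun j => (u j / u i).re, ?_⟩
  ext j
  have hreal : starRingEnd ℂ (u j / u i) = u j / u i := by
    rw [map_div₀, div_eq_div_iff ((map_ne_zero _).2 hi) hi]
    simp only [det2, conjVec] at h
    fin_cases i <;> fin_cases j <;> simp only [Fin.zero_eta, Fin.mk_one, Fin.isValue]
    · ring
    · linear_combination h
    · linear_combination -h
    · ring
  rw [Pi.smul_apply, smul_eq_mul, ofRealVec, Complex.conj_eq_iff_re.1 hreal]
  field_simp

/-- On the unit circle of parameters, the pencil spanned by `u` and its conjugate consists of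
multiples of real vectors. -/
lemma exists_sub_smul_conjVec_eq {η : ℂ} (hη : ‖η‖ = 1) (u : Fin 2 → ℂ) :
    ∃ (κ : ℂ) (p : Fin 2 → ℝ), u - η • conjVec u = κ • ofRealVec p := by
  -- For `|η| = 1`, conjugation multiplies `u - η ū` by the negative of the conjugate of `η`.
  apply exists_eq_smul_ofRealVec
  have h : η * starRingEnd ℂ η = 1 := by
    rw [Complex.mul_conj, Complex.normSq_eq_norm_sq, hη]
    simp
  simp only [det2, conjVec, Pi.sub_apply, Pi.smul_apply, smul_eq_mul, map_sub, map_mul,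
    Complex.conj_conj]
  linear_combination (starRingEnd ℂ (u 0) * u 1 - starRingEnd ℂ (u 1) * u 0) * h

lemma map_conj_map_ofReal (f : MvPolynomial (Fin 2) ℝ) :
    MvPolynomial.map (starRingEnd ℂ) (MvPolynomial.map (algebraMap ℝ ℂ) f) =
      MvPolynomial.map (algebraMap ℝ ℂ) f := by
  ext m
  simp [coeff_map]

/-- A complex form that equals its conjugate is real. -/
lemma exists_toComplex_eq {g : Form ℂ d}
    (hg : MvPolynomial.map (starRingEnd ℂ) (g : MvPolynomial (Fin 2) ℂ) = g) :
    ∃ f : Form ℝ d, toComplex d f = g := by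
  have hmem : (g : MvPolynomial (Fin 2) ℂ) ∈ Set.range (MvPolynomial.map (algebraMap ℝ ℂ)) := by
    rw [mem_range_map_iff_coeffs_subset]
    intro z hz
    obtain ⟨m, -, rfl⟩ := mem_coeffs_iff.1 hz
    have := congrArg (coeff m) hg
    rw [coeff_map, Complex.conj_eq_iff_re] at this
    exact ⟨_, this⟩
  obtain ⟨f, hf⟩ := hmem
  refine ⟨⟨f, IsHomogeneous.of_map (f := algebraMap ℝ ℂ) (algebraMap ℝ ℂ).injective ?_⟩,
    Subtype.ext hf⟩
  rw [hf]
  exact g.2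

/-- Real parts of the coefficients in a complex combination of real polynomials. -/
lemma eq_sum_re {ι : Type*} [Fintype ι] {f : MvPolynomial (Fin 2) ℝ} {κ : ι → ℂ}
    {P : ι → MvPolynomial (Fin 2) ℝ}
    (h : MvPolynomial.map (algebraMap ℝ ℂ) f =
      ∑ i, C (κ i) * MvPolynomial.map (algebraMap ℝ ℂ) (P i)) :
    f = ∑ i, C (κ i).re * P i := by
  ext m
  have := congrArg (fun p => (coeff m p).re) h
  simpa [coeff_sum, coeff_map, coeff_C_mul] using this

lemma coe_toComplex (f : Form ℝ d) :
    (toComplex d f : MvPolynomial (Fin 2) ℂ) = MvPolynomial.map (algebraMap ℝ ℂ) f.1 := rfl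

end Conjugation

/-! ### Generalities on Waring rank -/

section Waring

variable {K : Type*} [Field K] {d : ℕ}

lemma hasWaringDecomposition_iff {f : Form K d} {r : ℕ} :
    HasWaringDecomposition f r ↔ ∃ (a : Fin r → K) (v : Fin r → Fin 2 → K),
      (f : MvPolynomial (Fin 2) K) = ∑ i, C (a i) * linearPoly (v i) ^ d := by
  constructor
  · rintro ⟨a, L, h⟩
    choose v hv using fun i => linearForm_surjective (L i)
    exact ⟨a, v, by simpa only [linearPoly, hv] using h⟩
  · rintro ⟨a, v, h⟩
    exact ⟨a, fun i => linearForm (v i), h⟩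

/-- Over an algebraically closed field the scalars can be absorbed. -/
lemma HasWaringDecomposition.exists_sum_pow [IsAlgClosed K] (hd : 0 < d) {f : Form K d} {r : ℕ}
    (h : HasWaringDecomposition f r) : ∃ v : Fin r → Fin 2 → K,
      (f : MvPolynomial (Fin 2) K) = ∑ i, linearPoly (v i) ^ d := by
  obtain ⟨a, v, h⟩ := hasWaringDecomposition_iff.1 h
  choose b hb using fun i => IsAlgClosed.exists_pow_nat_eq (a i) hd
  refine ⟨fun i => b i • v i, ?_⟩
  rw [h]
  refine Finset.sum_congr rfl fun i _ => ?_
  rw [linearPoly_smul, mul_pow, ← map_pow, hb]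

/-- A sum of two powers of independent linear forms has rank at least two. -/
lemma two_le_of_hasWaringDecomposition [CharZero K] (hd : 2 ≤ d) {f : Form K d}
    {u v : Fin 2 → K} (huv : det2 u v ≠ 0)
    (hf : (f : MvPolynomial (Fin 2) K) = linearPoly u ^ d + linearPoly v ^ d) {r : ℕ}
    (h : HasWaringDecomposition f r) : 2 ≤ r := by
  by_contra! hr
  obtain ⟨a, w, h⟩ := hasWaringDecomposition_iff.1 h
  -- If no nonzero `w i` were proportional to `u`, then `u ^ d` would be a combination of at most
  -- two powers of other forms. By symmetry the same holds for `v`, but there is at most one `w i`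
  -- to share.
  have aux : ∀ u v : Fin 2 → K, det2 u v ≠ 0 →
      (f : MvPolynomial (Fin 2) K) = linearPoly u ^ d + linearPoly v ^ d →
      ∃ i, w i ≠ 0 ∧ det2 (w i) u = 0 := by
    intro u v huv hf
    by_contra! hcon
    refine one_ne_zero (α := K) (eq_zero_of_add_sum_eq_zero (d := d) (ι := Option (Fin r))
      (c := 1) (u := u) (a := fun o => o.elim 1 fun i => -a i) (v := fun o => o.elim v w)
      ?_ ?_ (ne_zero_of_det2_left huv) ?_)
    · rw [Fintype.sum_option]
      simp only [Option.elim, map_one, map_neg, one_mul, neg_mul, Finset.sum_neg_distrib]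
      rw [← h, hf]
      ring
    · simp
      omega
    · rintro (_ | i)
      · intro _
        rw [det2_comm]
        exact neg_ne_zero.2 huv
      · exact hcon i
  obtain ⟨i, hi, hiu⟩ := aux u v huv hf
  obtain ⟨j, -, hjv⟩ := aux v u (by rw [det2_comm]; exact neg_ne_zero.2 huv)
    (by rw [hf, add_comm])
  have : j = i := Fin.ext (by omega)
  subst this
  exact det2_ne_zero_of_det2_eq_zero huv hi hiu hjv

lemma formRank_le {f : Form K d} {r : ℕ} (h : HasWaringDecomposition f r) : formRank f ≤ r :=
  Nat.sInf_le h

/-- Some decomposition has to be given, since `sInf` of the empty set is the default value 0. -/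
lemma HasWaringDecomposition.formRank {f : Form K d} {r : ℕ} (h : HasWaringDecomposition f r) :
    HasWaringDecomposition f (formRank f) :=
  Nat.sInf_mem (s := {r | HasWaringDecomposition f r}) ⟨r, h⟩

lemma HasWaringDecomposition.toComplex {f : Form ℝ d} {r : ℕ} (h : HasWaringDecomposition f r) :
    HasWaringDecomposition (toComplex d f) r := by
  obtain ⟨a, v, h⟩ := hasWaringDecomposition_iff.1 h
  refine hasWaringDecomposition_iff.2 ⟨fun i => a i, fun i => ofRealVec (v i), ?_⟩
  rw [coe_toComplex, h]
  simp [map_ofReal_linearPoly]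

end Waring

/-! ### Conjugate pairs: ranks and hyperbolicity -/

section ConjPair

variable {d : ℕ}

/-- A real form which is the sum of the powers of a complex linear form and of its conjugate,
the two being independent. -/
def IsConjPair (f : Form ℝ d) : Prop :=
  ∃ u : Fin 2 → ℂ, det2 u (conjVec u) ≠ 0 ∧
    (toComplex d f : MvPolynomial (Fin 2) ℂ) = linearPoly u ^ d + linearPoly (conjVec u) ^ d

lemma exists_conjPair (d : ℕ) (u : Fin 2 → ℂ) : ∃ f : Form ℝ d,
    (toComplex d f : MvPolynomial (Fin 2) ℂ) = linearPoly u ^ d + linearPoly (conjVec u) ^ d := by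
  obtain ⟨f, hf⟩ := exists_toComplex_eq (d := d)
    (g := ⟨linearPoly u ^ d + linearPoly (conjVec u) ^ d,
      (linearPoly_pow_isHomogeneous u d).add (linearPoly_pow_isHomogeneous _ d)⟩)
    (by simp [map_conj_linearPoly, add_comm])
  exact ⟨f, by rw [hf]⟩

/-- With `r < d`, the power `u ^ d` would be a combination of `ū ^ d` and `r` real powers, at most
`d` in all. No nonzero real vector is proportional to `u`, as it would then be proportional to `ū`
too. -/
lemma IsConjPair.le_of_hasWaringDecomposition {f : Form ℝ d} (hf : IsConjPair f) {r : ℕ}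
    (h : HasWaringDecomposition f r) : d ≤ r := by
  by_contra! hr
  obtain ⟨u, hu, hf⟩ := hf
  obtain ⟨a, p, h⟩ := hasWaringDecomposition_iff.1 h
  rw [coe_toComplex, h] at hf
  simp only [map_sum, map_mul, map_C, map_pow, map_ofReal_linearPoly] at hf
  refine one_ne_zero (α := ℂ) (eq_zero_of_add_sum_eq_zero (d := d) (ι := Option (Fin r))
    (c := 1) (u := u) (a := fun o => o.elim 1 fun i => -algebraMap ℝ ℂ (a i))
    (v := fun o => o.elim (conjVec u) fun i => ofRealVec (p i)) ?_ ?_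
    (ne_zero_of_det2_left hu) ?_)
  · rw [Fintype.sum_option]
    simp only [Option.elim, map_one, map_neg, one_mul, neg_mul, Finset.sum_neg_distrib]
    rw [hf]
    ring
  · simp
    omega
  · rintro (_ | i)
    · intro _
      rw [det2_comm]
      exact neg_ne_zero.2 hu
    · intro hi (h0 : det2 (ofRealVec (p i)) u = 0)
      refine det2_ne_zero_of_det2_eq_zero hu hi h0 ?_
      change det2 (ofRealVec (p i)) (conjVec u) = 0
      have := congrArg (starRingEnd ℂ) h0
      rwa [← det2_conjVec, conjVec_ofRealVec, map_zero] at this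

lemma IsConjPair.formRank_eq (hd : 0 < d) {f : Form ℝ d} (hf : IsConjPair f) :
    formRank f = d :=
  le_antisymm (formRank_le (hasWaringDecomposition_real hd f))
    (hf.le_of_hasWaringDecomposition (hasWaringDecomposition_real hd f).formRank)

lemma IsConjPair.formRank_toComplex (hd : 2 ≤ d) {f : Form ℝ d} (hf : IsConjPair f) :
    formRank (toComplex d f) = 2 := by
  obtain ⟨u, hu, hf⟩ := hf
  have h2 : HasWaringDecomposition (toComplex d f) 2 :=
    hasWaringDecomposition_iff.2 ⟨![1, 1], ![u, conjVec u], by simp [hf, Fin.sum_univ_two]⟩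
  exact le_antisymm (formRank_le h2) (two_le_of_hasWaringDecomposition hd hu hf h2.formRank)

lemma IsConjPair.ne_zero (hd : 2 ≤ d) {f : Form ℝ d} (hf : IsConjPair f) : f ≠ 0 := by
  rintro rfl
  have h0 : HasWaringDecomposition (0 : Form ℝ d) 0 := ⟨0, 0, by simp⟩
  have := hf.le_of_hasWaringDecomposition h0
  omega

/-- Such an `ε` turns a sum of `d`-th powers into a difference without leaving the unit circle. -/
lemma exists_norm_eq_one_pow_eq_neg_one (hd : 0 < d) : ∃ ε : ℂ, ‖ε‖ = 1 ∧ ε ^ d = -1 := by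
  obtain ⟨ε, h⟩ := IsAlgClosed.exists_pow_nat_eq (-1 : ℂ) hd
  refine ⟨ε, ?_, h⟩
  have := congrArg norm h
  rw [norm_pow, norm_neg, norm_one] at this
  exact (pow_eq_one_iff_of_nonneg (norm_nonneg _) hd.ne').1 this

theorem IsConjPair.formHyperbolic (hd : 0 < d) {f : Form ℝ d} (hf : IsConjPair f) :
    FormHyperbolic f := by
  obtain ⟨u, hu, hf⟩ := hf
  obtain ⟨ε, hε, hεd⟩ := exists_norm_eq_one_pow_eq_neg_one hd
  have : NeZero d := ⟨hd.ne'⟩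
  have hprim := Complex.isPrimitiveRoot_exp d hd.ne'
  -- The factorization of a difference of powers takes place in the polynomial ring, so the roots of
  -- unity are moved there as constants.
  have hC : IsPrimitiveRoot (C (Complex.exp (2 * Real.pi * Complex.I / d)) :
      MvPolynomial (Fin 2) ℂ) d := hprim.map_of_injective (C_injective (Fin 2) ℂ)
  have hcard : (Polynomial.nthRootsFinset d (1 : MvPolynomial (Fin 2) ℂ)).card = d :=
    hC.card_nthRootsFinset
  let e := (Polynomial.nthRootsFinset d (1 : MvPolynomial (Fin 2) ℂ)).equivFinOfCardEq hcard
  have hfac : ∀ i : Fin d, ∃ (κ : ℂ) (p : Fin 2 → ℝ),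
      linearPoly u - (e.symm i).1 * linearPoly (ε • conjVec u) =
        C κ * MvPolynomial.map (algebraMap ℝ ℂ) (linearPoly p) := by
    intro i
    have hmem := (Polynomial.mem_nthRootsFinset hd (1 : MvPolynomial (Fin 2) ℂ)).1 (e.symm i).2
    obtain ⟨k, -, hk⟩ := hC.eq_pow_of_pow_eq_one hmem
    set ζ : ℂ := Complex.exp (2 * Real.pi * Complex.I / d) ^ k
    have hζ : (e.symm i).1 = C ζ := by rw [← hk, ← map_pow]
    have hnorm : ‖ζ * ε‖ = 1 := by
      rw [norm_mul, hε, mul_one, norm_pow, hprim.norm'_eq_one hd.ne', one_pow]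
    obtain ⟨κ, p, h⟩ := exists_sub_smul_conjVec_eq hnorm u
    refine ⟨κ, p, ?_⟩
    rw [hζ, ← linearPoly_smul, smul_smul, map_ofReal_linearPoly, ← linearPoly_smul, ← h]
    simp [linearPoly, linearForm]
    ring
  choose κ p hfac using hfac
  have hprod : (toComplex d f : MvPolynomial (Fin 2) ℂ) =
      ∏ i, C (κ i) * MvPolynomial.map (algebraMap ℝ ℂ) (linearPoly (p i)) := by
    have h1 : linearPoly (conjVec u) ^ d = -linearPoly (ε • conjVec u) ^ d := by
      rw [linearPoly_smul, mul_pow, ← map_pow, hεd]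
      simp
    rw [hf, h1, ← sub_eq_add_neg, hC.pow_sub_pow_eq_prod_sub_mul _ _ hd, ← Finset.prod_coe_sort,
      ← Equiv.prod_comp e.symm]
    exact Finset.prod_congr rfl fun i _ => hfac i
  have hre := eq_sum_re (ι := Unit) (f := f.1) (κ := fun _ => ∏ i, κ i)
    (P := fun _ => ∏ i, linearPoly (p i)) (by
      rw [← coe_toComplex, hprod, Finset.prod_mul_distrib]
      simp)
  exact ⟨_, fun i => linearForm (p i), by simpa using hre⟩

end ConjPair

/-! ### Real forms of complex rank one and two -/

section Classification

variable {d : ℕ}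

/-- A real form which is a complex power is a multiple of a real power. -/
lemma hasWaringDecomposition_one_of_toComplex (hd : 0 < d) {f : Form ℝ d}
    (h : HasWaringDecomposition (toComplex d f) 1) : HasWaringDecomposition f 1 := by
  obtain ⟨v, hv⟩ := h.exists_sum_pow hd
  rw [Fin.sum_univ_one] at hv
  set u := v 0
  have hconj : linearPoly (conjVec u) ^ d = linearPoly u ^ d := by
    rw [← map_conj_linearPoly, ← map_pow, ← hv, coe_toComplex, map_conj_map_ofReal]
  have hdet : det2 u (conjVec u) = 0 := by
    by_contra hu
    refine one_ne_zero (α := ℂ) (eq_zero_of_add_sum_eq_zero (d := d) (ι := Unit)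
      (c := 1) (u := u) (a := fun _ => -1) (v := fun _ => conjVec u) (by simp [hconj])
      (by simp; omega) (ne_zero_of_det2_left hu) fun _ _ => ?_)
    rw [det2_comm]
    exact neg_ne_zero.2 hu
  obtain ⟨κ, p, hu⟩ := exists_eq_smul_ofRealVec hdet
  refine hasWaringDecomposition_iff.2 ⟨fun _ => (κ ^ d).re, fun _ => p, ?_⟩
  refine eq_sum_re (κ := fun _ : Fin 1 => κ ^ d) (P := fun _ => linearPoly p ^ d) ?_
  rw [← coe_toComplex, hv, hu, linearPoly_smul]
  simp [map_ofReal_linearPoly, mul_pow]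

/-- A real root can be multiplied by a primitive root `ζ`. Were `ζ` real, modulus one would give `ζ
^ 2 = 1`, against `d ≥ 3`. -/
lemma exists_pow_eq_im_ne_zero (hd : 3 ≤ d) {a : ℂ} (ha : a ≠ 0) :
    ∃ t : ℂ, t ^ d = a ∧ t.im ≠ 0 := by
  obtain ⟨t, ht⟩ := IsAlgClosed.exists_pow_nat_eq a (show 0 < d by omega)
  have hprim := Complex.isPrimitiveRoot_exp d (show d ≠ 0 by omega)
  set ζ := Complex.exp (2 * Real.pi * Complex.I / d)
  by_cases him : t.im = 0
  · refine ⟨ζ * t, by rw [mul_pow, hprim.pow_eq_one, one_mul, ht], fun h => ?_⟩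
    have ht0 : t.re ≠ 0 := by
      intro h0
      have : t = 0 := Complex.ext h0 him
      rw [this, zero_pow (by omega)] at ht
      exact ha ht.symm
    have hζ : ζ.im = 0 := by
      rw [Complex.mul_im, him, mul_zero, zero_add] at h
      exact (mul_eq_zero.1 h).resolve_right ht0
    have hsq : ζ ^ 2 = 1 := by
      have h1 : ζ = (ζ.re : ℂ) := Complex.ext rfl hζ
      have h2 := hprim.norm'_eq_one (by omega)
      rw [h1, Complex.norm_real, Real.norm_eq_abs, abs_eq zero_le_one] at h2
      rw [h1]
      rcases h2 with h2 | h2 <;> rw [h2] <;> simp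
    have := Nat.le_of_dvd two_pos (hprim.dvd_of_pow_eq_one 2 hsq)
    omega
  · exact ⟨t, ht, him⟩

/-- A combination of two powers of real independent linear forms is not hyperbolic. -/
lemma not_formHyperbolic (hd : 3 ≤ d) {f : Form ℝ d} (hf0 : f ≠ 0) {κ μ : ℂ} (hκ : κ ≠ 0)
    (hμ : μ ≠ 0) {p q : Fin 2 → ℝ} (hpq : det2 p q ≠ 0)
    (hf : (toComplex d f : MvPolynomial (Fin 2) ℂ) =
      linearPoly (κ • ofRealVec p) ^ d + linearPoly (μ • ofRealVec q) ^ d) :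
    ¬ FormHyperbolic f := by
  rintro ⟨c, L, h⟩
  choose l hl using fun i => linearForm_surjective (L i)
  have hf0' : (f : MvPolynomial (Fin 2) ℝ) ≠ 0 := fun h => hf0 (Subtype.ext h)
  obtain ⟨t, ht, him⟩ := exists_pow_eq_im_ne_zero hd
    (a := -(μ / κ) ^ d) (neg_ne_zero.2 (pow_ne_zero _ (div_ne_zero hμ hκ)))
  -- At this point the forms of `p` and `q` take the values `t * det2 p q` and `det2 p q`, so the
  -- choice of `t ^ d` makes the two powers cancel.
  have hroot : eval ![t * q 1 - p 1, p 0 - t * q 0]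
      (toComplex d f : MvPolynomial (Fin 2) ℂ) = 0 := by
    rw [hf]
    simp only [map_add, map_pow, linearPoly_smul, map_mul, eval_C, eval_linearPoly, ofRealVec,
      Matrix.cons_val_zero, Matrix.cons_val_one]
    have h1 : (p 0 : ℂ) * (t * q 1 - p 1) + p 1 * (p 0 - t * q 0) =
        t * (p 0 * q 1 - p 1 * q 0) := by ring
    have h2 : (q 0 : ℂ) * (t * q 1 - p 1) + q 1 * (p 0 - t * q 0) =
        p 0 * q 1 - p 1 * q 0 := by ring
    rw [h1, h2, mul_pow, mul_pow, mul_pow, ht, div_pow]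
    have := pow_ne_zero d hκ
    field_simp
    ring
  rw [coe_toComplex, h, map_mul, map_mul, map_prod, map_prod, mul_eq_zero] at hroot
  rcases hroot with hc | hprod
  · rw [map_C, eval_C, Complex.coe_algebraMap, Complex.ofReal_eq_zero] at hc
    rw [h, hc] at hf0'
    simp at hf0'
  · obtain ⟨i, -, hi⟩ := Finset.prod_eq_zero_iff.1 hprod
    rw [← hl i, map_ofReal_linearPoly, eval_linearPoly] at hi
    simp only [ofRealVec, Matrix.cons_val_zero, Matrix.cons_val_one] at hi
    -- Since `t` is not real, imaginary and real parts show that the real factor `l i` is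
    -- proportional to both `q` and `p`, hence zero.
    have h1 : t.im * (l i 0 * q 1 - l i 1 * q 0) = 0 := by
      have := congrArg Complex.im hi
      simp at this
      linarith
    have h2 := (mul_eq_zero.1 h1).resolve_left him
    have h3 : l i 0 * p 1 - l i 1 * p 0 = 0 := by
      have := congrArg Complex.re hi
      simp at this
      linear_combination t.re * h2 - this
    have h4 : l i = 0 := by
      unfold det2 at hpq
      ext j
      apply (mul_eq_zero.1 _).resolve_left hpq
      fin_cases j <;> simp only [Fin.zero_eta, Fin.mk_one, Fin.isValue]
      · linear_combination p 0 * h2 - q 0 * h3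
      · linear_combination p 1 * h2 - q 1 * h3
    apply hf0'
    rw [h, Finset.prod_eq_zero (Finset.mem_univ i), mul_zero]
    rw [← hl i, h4, linearForm_zero]
    rfl

/-- A real form of complex rank two is a conjugate pair, or it has real rank at most two and is
not hyperbolic. -/
theorem isConjPair_or_of_formRank_eq_two (hd : 3 ≤ d) {f : Form ℝ d} (hf0 : f ≠ 0)
    (hf : formRank (toComplex d f) = 2) :
    IsConjPair f ∨ HasWaringDecomposition f 2 ∧ ¬ FormHyperbolic f := by
  have h2 := (hasWaringDecomposition_real (show 0 < d by omega) f).toComplex.formRank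
  rw [hf] at h2
  obtain ⟨w, hw⟩ := h2.exists_sum_pow (by omega)
  rw [Fin.sum_univ_two] at hw
  set u := w 0
  set v := w 1
  have hu0 : u ≠ 0 := by
    intro h0
    rw [h0, linearPoly, linearForm_zero, ZeroMemClass.coe_zero, zero_pow (by omega),
      zero_add] at hw
    have : HasWaringDecomposition (toComplex d f) 1 :=
      hasWaringDecomposition_iff.2 ⟨fun _ => 1, fun _ => v, by simp [hw]⟩
    have := formRank_le this
    omega
  have huv : det2 u v ≠ 0 := by
    intro h0
    obtain ⟨t, ht⟩ := exists_eq_smul_of_det2_eq_zero (v := v) hu0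
      (by rw [det2_comm, h0, neg_zero])
    have : HasWaringDecomposition (toComplex d f) 1 :=
      hasWaringDecomposition_iff.2 ⟨fun _ => 1 + t ^ d, fun _ => u, by
        rw [hw, ht, linearPoly_smul]
        simp
        ring⟩
    have := formRank_le this
    omega
  have hv0 := ne_zero_of_det2_right huv
  have hvu : det2 v u ≠ 0 := by
    rw [det2_comm]
    exact neg_ne_zero.2 huv
  have hconj : linearPoly (conjVec u) ^ d + linearPoly (conjVec v) ^ d =
      linearPoly u ^ d + linearPoly v ^ d := by
    rw [← map_conj_linearPoly, ← map_conj_linearPoly, ← map_pow, ← map_pow, ← map_add, ← hw,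
      coe_toComplex, map_conj_map_ofReal]
  -- Otherwise `u ^ d` would be a combination of three powers of forms not proportional to `u`,
  -- impossible for `d ≥ 3`.
  have aux : ∀ u v : Fin 2 → ℂ, det2 v u ≠ 0 →
      linearPoly (conjVec u) ^ d + linearPoly (conjVec v) ^ d =
        linearPoly u ^ d + linearPoly v ^ d →
      det2 u (conjVec u) = 0 ∨ det2 u (conjVec v) = 0 := by
    intro u v hvu hconj
    by_contra! hcon
    refine one_ne_zero (α := ℂ) (eq_zero_of_add_sum_eq_zero (d := d) (ι := Fin 3)
      (c := 1) (u := u) (a := ![1, -1, -1]) (v := ![v, conjVec u, conjVec v]) ?_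
      (by simpa using hd) (ne_zero_of_det2_right hvu) fun i _ => ?_)
    · simp [Fin.sum_univ_three]
      linear_combination -hconj
    · fin_cases i
      · exact hvu
      · change det2 (conjVec u) u ≠ 0
        rw [det2_comm]
        exact neg_ne_zero.2 hcon.1
      · change det2 (conjVec v) u ≠ 0
        rw [det2_comm]
        exact neg_ne_zero.2 hcon.2
  have pair : det2 u (conjVec v) = 0 → IsConjPair f := by
    intro h0
    have h0' : det2 v (conjVec u) = 0 := by
      have := congrArg (starRingEnd ℂ) h0
      rw [← det2_conjVec, conjVec_conjVec, map_zero] at this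
      rw [det2_comm, this, neg_zero]
    have hcu0 : conjVec u ≠ 0 := fun h => hu0 (by rw [← conjVec_conjVec u, h]; ext; simp [conjVec])
    obtain ⟨t, ht⟩ := exists_eq_smul_of_det2_eq_zero hcu0 h0'
    have hdet : det2 u (conjVec u) ≠ 0 := by
      intro h
      rw [ht, det2_smul_right, h, mul_zero] at huv
      exact huv rfl
    -- With `v = t ū`, this is the coefficient of `ū ^ d` in the relation expressing that `f` is
    -- real.
    have htd : 1 - t ^ d = 0 := by
      refine eq_zero_of_add_sum_eq_zero (d := d) (ι := Unit) (u := conjVec u)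
        (a := fun _ => (starRingEnd ℂ t) ^ d - 1) (v := fun _ => u) ?_
        (by simp; omega) hcu0 fun _ _ => hdet
      rw [ht, conjVec_smul, conjVec_conjVec, linearPoly_smul, linearPoly_smul, mul_pow,
        mul_pow] at hconj
      simp
      linear_combination hconj
    refine ⟨u, hdet, ?_⟩
    rw [hw, ht, linearPoly_smul, mul_pow, ← map_pow, ← sub_eq_zero.1 htd]
    simp
  rcases aux u v hvu hconj with hu | hu
  · rcases aux v u huv (by rw [add_comm, hconj, add_comm]) with hv | hv
    · right
      obtain ⟨κ, p, hp⟩ := exists_eq_smul_ofRealVec hu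
      obtain ⟨μ, q, hq⟩ := exists_eq_smul_ofRealVec hv
      have hκ : κ ≠ 0 := fun h => hu0 (by rw [hp, h, zero_smul])
      have hμ : μ ≠ 0 := fun h => hv0 (by rw [hq, h, zero_smul])
      have hpq : det2 p q ≠ 0 := by
        intro h
        rw [hp, hq, det2_smul_left, det2_smul_right, det2_ofRealVec, h] at huv
        simp at huv
      refine ⟨hasWaringDecomposition_iff.2 ⟨fun i => (![κ ^ d, μ ^ d] i).re, ![p, q], ?_⟩,
        not_formHyperbolic hd hf0 hκ hμ hpq (by rw [hw, hp, hq])⟩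
      refine eq_sum_re (κ := ![κ ^ d, μ ^ d]) (P := fun i => linearPoly (![p, q] i) ^ d) ?_
      rw [← coe_toComplex, hw, hp, hq, linearPoly_smul, linearPoly_smul]
      simp [map_ofReal_linearPoly, mul_pow, Fin.sum_univ_two]
    · left
      apply pair
      have := congrArg (starRingEnd ℂ) hv
      rw [← det2_conjVec, conjVec_conjVec, map_zero] at this
      rw [det2_comm, this, neg_zero]
  · exact Or.inl (pair hu)

lemma formRank_ne_zero {K : Type*} [Field K] {f : Form K d} (hf : f ≠ 0) {r : ℕ}
    (h : HasWaringDecomposition f r) : formRank f ≠ 0 := by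
  intro h0
  have := h.formRank
  rw [h0] at this
  obtain ⟨a, L, h⟩ := this
  exact hf (Subtype.ext (by simpa using h))

lemma toComplex_ne_zero {f : Form ℝ d} (hf : f ≠ 0) : toComplex d f ≠ 0 := fun h =>
  hf (toComplex_injective d (h.trans (map_zero _).symm))

/-- Outside conjugate pairs, complex rank 1 or 2 forces a gap of at most 0, and complex rank at
least 3 a gap of at most `d - 3`. -/
lemma formRank_gap (hd : 4 ≤ d) {f : Form ℝ d} (hf : f ≠ 0) :
    (formRank f : ℤ) - formRank (toComplex d f) ≤ d - 2 ∧
      ((formRank f : ℤ) - formRank (toComplex d f) = d - 2 ↔ IsConjPair f) := by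
  have hreal := hasWaringDecomposition_real (show 0 < d by omega) f
  have hle := formRank_le hreal
  have hcompl := hreal.toComplex
  have hne := formRank_ne_zero (toComplex_ne_zero hf) hcompl
  by_cases hpair : IsConjPair f
  · have h1 := hpair.formRank_eq (by omega)
    have h2 := hpair.formRank_toComplex (by omega)
    rw [h1, h2]
    simp [hpair]
  · have hlt : (formRank f : ℤ) - formRank (toComplex d f) < d - 2 := by
      rcases lt_trichotomy (formRank (toComplex d f)) 2 with h | h | h
      · have h1 : formRank (toComplex d f) = 1 := by omega
        have := hcompl.formRank
        rw [h1] at this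
        have := formRank_le (hasWaringDecomposition_one_of_toComplex (by omega) this)
        omega
      · have := formRank_le
          ((isConjPair_or_of_formRank_eq_two (by omega) hf h).resolve_left hpair).1
        omega
      · omega
    exact ⟨hlt.le, iff_of_false hlt.ne hpair⟩

lemma isConjPair_iff (hd : 4 ≤ d) {f : Form ℝ d} (hf : f ≠ 0) :
    IsConjPair f ↔ formRank (toComplex d f) = 2 ∧ FormHyperbolic f :=
  ⟨fun h => ⟨h.formRank_toComplex (by omega), h.formHyperbolic (by omega)⟩, fun h =>
    (isConjPair_or_of_formRank_eq_two (by omega) hf h.1).resolve_right fun h' => h'.2 h.2⟩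

end Classification

/-! ### The maximal gap and where it is attained -/

section MaximalGap

variable {d : ℕ}

lemma complexify_mk {f : Form ℝ d} (hf : f ≠ 0) :
    complexify d (Projectivization.mk ℝ f hf) =
      Projectivization.mk ℂ (toComplex d f) (toComplex_ne_zero hf) := rfl

lemma rankGap_mk {f : Form ℝ d} (hf : f ≠ 0) :
    rankGap (Projectivization.mk ℝ f hf) = (formRank f : ℤ) - formRank (toComplex d f) := rfl

/-- The witness is twice the real part of `(x + i y) ^ d`. -/
lemma exists_isConjPair (d : ℕ) : ∃ f : Form ℝ d, IsConjPair f := by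
  obtain ⟨f, hf⟩ := exists_conjPair d ![1, Complex.I]
  refine ⟨f, _, ?_, hf⟩
  simp only [det2, conjVec, Matrix.cons_val_zero, Matrix.cons_val_one, map_one, Complex.conj_I]
  intro h
  have := congrArg Complex.im h
  norm_num at this

theorem isGreatest_range_rankGap (hd : 4 ≤ d) :
    IsGreatest (Set.range (rankGap (d := d))) ((d : ℤ) - 2) := by
  constructor
  · obtain ⟨f, hf⟩ := exists_isConjPair d
    have hf0 := hf.ne_zero (by omega)
    exact ⟨Projectivization.mk ℝ f hf0, (formRank_gap hd hf0).2.2 hf⟩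
  · rintro _ ⟨F, rfl⟩
    induction F using Projectivization.ind with | h f hf =>
    exact (formRank_gap hd hf).1

theorem mk_mem_maximalGapSet_iff (hd : 4 ≤ d) {f : Form ℝ d} (hf : f ≠ 0) :
    Projectivization.mk ℝ f hf ∈ maximalGapSet d ↔ IsConjPair f := by
  rw [← (formRank_gap hd hf).2, ← rankGap_mk hf]
  obtain ⟨⟨G, hG⟩, hub⟩ := isGreatest_range_rankGap hd
  constructor
  · intro h
    exact le_antisymm (hub ⟨_, rfl⟩) (hG ▸ h G)
  · intro h H
    rw [h]
    exact hub ⟨H, rfl⟩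

end MaximalGap

/-! ### The images of the maps `Γ` -/

section GammaImage

variable {d : ℕ}

/-- Uniqueness lets an explicit `φ` replace the chosen one. -/
lemma Gamma_eq {hd : d ≠ 0} {L : Fin 3 ↪ ℙ ℂ (Form ℂ 1)} {ξ : Fin 3 ↪ rootsOfUnity d ℂ}
    {φ : PGL(2, ℂ)} (hφ : ∀ k, φ • rootTriple ξ k = L k) :
    Gamma d hd L ξ = φ • Projectivization.mk ℂ (powSub d) (powSub_ne_zero hd) := by
  have h := (existsUnique_smul_triple (rootTriple ξ) L).choose_spec
  rw [Gamma, h.2 φ hφ]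

lemma coe_smul_powSub (α : GL (Fin 2) ℂ) : ((α • powSub d : Form ℂ d) : MvPolynomial (Fin 2) ℂ) =
    linearPoly (fun i => α.1 i 0) ^ d - linearPoly (fun i => α.1 i 1) ^ d := by
  rw [coe_smul, powSub, map_sub, map_pow, map_pow, substitution_X, substitution_X]
  rfl

lemma ofRealVec_ne_zero {p : Fin 2 → ℝ} (hp : p ≠ 0) : ofRealVec p ≠ 0 := by
  intro h
  refine hp (funext fun i => ?_)
  have := congrFun h i
  simpa [ofRealVec] using this

lemma complexify_linearPoint {p : Fin 2 → ℝ} (hp : p ≠ 0) :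
    complexify 1 (linearPoint p hp) = linearPoint (ofRealVec p) (ofRealVec_ne_zero hp) := by
  rw [linearPoint, complexify_mk, linearPoint]
  congr 1
  exact Subtype.ext (map_ofReal_linearPoly p)

lemma smul_rootTriple (α : GL (Fin 2) ℂ) (ξ : Fin 3 ↪ rootsOfUnity d ℂ) (k : Fin 3) :
    ∃ h, (Matrix.ProjGenLinGroup.mk α : PGL(2, ℂ)) • rootTriple ξ k =
      linearPoint ((fun i => α.1 i 0) - ((ξ k : ℂˣ) : ℂ) • fun i => α.1 i 1) h := by
  have hv : (![1, -((ξ k : ℂˣ) : ℂ)] : Fin 2 → ℂ) ≠ 0 := by simp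
  have heq : α.1.mulVec ![1, -((ξ k : ℂˣ) : ℂ)] =
      (fun i => α.1 i 0) - ((ξ k : ℂˣ) : ℂ) • fun i => α.1 i 1 := by
    ext i
    simp [Matrix.mulVec, dotProduct, Fin.sum_univ_two]
    ring
  have hne := mulVec_ne_zero α hv
  have h := mk_smul_linearPoint α _ hv hne
  simp only [heq] at h hne
  exact ⟨hne, h⟩

lemma det2_columns_ne_zero (α : GL (Fin 2) ℂ) :
    det2 (fun i => α.1 i 0) (fun i => α.1 i 1) ≠ 0 := by
  have h : α.1.det ≠ 0 := ((Matrix.isUnit_iff_isUnit_det _).1 α.isUnit).ne_zero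
  rw [Matrix.det_fin_two] at h
  simp only [det2]
  intro h'
  apply h
  linear_combination h'

/-- A Möbius transformation that maps three points of the unit circle to real points maps the
whole circle to the real line. -/
lemma exists_eq_smul_conjVec {u v : Fin 2 → ℂ} (huv : det2 u v ≠ 0) {η : Fin 3 → ℂ}
    (hinj : Function.Injective η) (hη : ∀ k, ‖η k‖ = 1)
    (h : ∀ k, det2 (u - η k • v) (conjVec (u - η k • v)) = 0) :
    ∃ t : ℂ, ‖t‖ = 1 ∧ v = t • conjVec u ∧ det2 u (conjVec u) ≠ 0 := by
  have hmul : ∀ z : ℂ, ‖z‖ = 1 → z * starRingEnd ℂ z = 1 := fun z hz => by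
    rw [Complex.mul_conj, Complex.normSq_eq_norm_sq, hz]
    simp
  set P := det2 u (conjVec u) + det2 v (conjVec v) with hP
  set Q := det2 (conjVec u) v with hQ
  set R := det2 u (conjVec v) with hR
  -- Multiplying the reality condition by `η`, whose conjugate is its inverse, gives a quadratic
  -- equation. Its three distinct roots force `Q = 0` and `P = 0`.
  have key : ∀ k, P * η k + Q * η k ^ 2 - R = 0 := by
    intro k
    have h1 := h k
    have h2 := hmul _ (hη k)
    simp only [det2, conjVec, Pi.sub_apply, Pi.smul_apply, smul_eq_mul, map_sub, map_mul]
      at h1 hP hQ hR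
    rw [hP, hQ, hR]
    linear_combination η k * h1 + (u 0 * starRingEnd ℂ (v 1) - u 1 * starRingEnd ℂ (v 0) -
      η k * (v 0 * starRingEnd ℂ (v 1) - v 1 * starRingEnd ℂ (v 0))) * h2
  have h01 : η 0 - η 1 ≠ 0 := sub_ne_zero.2 (hinj.ne (by decide))
  have h02 : η 0 - η 2 ≠ 0 := sub_ne_zero.2 (hinj.ne (by decide))
  have h12 : η 1 - η 2 ≠ 0 := sub_ne_zero.2 (hinj.ne (by decide))
  have e1 : P + Q * (η 0 + η 1) = 0 := (mul_eq_zero.1 (by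
    linear_combination key 0 - key 1 : (η 0 - η 1) * _ = 0)).resolve_left h01
  have e2 : P + Q * (η 0 + η 2) = 0 := (mul_eq_zero.1 (by
    linear_combination key 0 - key 2 : (η 0 - η 2) * _ = 0)).resolve_left h02
  have hQ0 : Q = 0 := (mul_eq_zero.1 (by
    linear_combination e1 - e2 : (η 1 - η 2) * Q = 0)).resolve_left h12
  have hP0 : P = 0 := by
    rw [hQ0, zero_mul, add_zero] at e1
    exact e1
  have hu := ne_zero_of_det2_left huv
  have hcu : conjVec u ≠ 0 := fun h0 => hu (by rw [← conjVec_conjVec u, h0]; ext; simp [conjVec])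
  obtain ⟨t, ht⟩ := exists_eq_smul_of_det2_eq_zero (v := v) hcu
    (by rw [det2_comm, ← hQ, hQ0, neg_zero])
  have hD : det2 u (conjVec u) ≠ 0 := by
    intro h0
    rw [ht, det2_smul_right, h0, mul_zero] at huv
    exact huv rfl
  refine ⟨t, ?_, ht, hD⟩
  -- With `v = t ū`, the left-hand side is exactly `P`.
  have hsq : (1 - t * starRingEnd ℂ t) * det2 u (conjVec u) = 0 := by
    rw [ht, conjVec_smul, conjVec_conjVec, det2_smul_left, det2_smul_right,
      det2_comm (conjVec u) u] at hP
    linear_combination hP0 - hP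
  have h1 := (mul_eq_zero.1 hsq).resolve_right hD
  rw [Complex.mul_conj, Complex.normSq_eq_norm_sq, sub_eq_zero] at h1
  have h2 : ‖t‖ ^ 2 = 1 := by exact_mod_cast h1.symm
  exact (pow_eq_one_iff_of_nonneg (norm_nonneg t) two_ne_zero).1 h2

lemma norm_rootsOfUnity (hd : d ≠ 0) (ζ : rootsOfUnity d ℂ) : ‖((ζ : ℂˣ) : ℂ)‖ = 1 :=
  have : NeZero d := ⟨hd⟩
  Complex.norm_eq_one_of_mem_rootsOfUnity ζ.2

lemma Gamma_mem_image (hd : 4 ≤ d) (hd0 : d ≠ 0) (L : Fin 3 ↪ ℙ ℝ (Form ℝ 1))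
    (ξ : Fin 3 ↪ rootsOfUnity d ℂ) :
    Gamma d hd0 (L.trans (complexify 1)) ξ ∈ complexify d '' maximalGapSet d := by
  obtain ⟨φ, hφ, -⟩ := existsUnique_smul_triple (rootTriple ξ) (L.trans (complexify 1))
  rw [Gamma_eq hφ]
  obtain ⟨α, rfl⟩ := Matrix.ProjGenLinGroup.mk_surjective φ
  rw [mk_smul_mk]
  set u : Fin 2 → ℂ := fun i => α.1 i 0 with hu
  set v : Fin 2 → ℂ := fun i => α.1 i 1 with hv
  have hreal : ∀ k, det2 (u - ((ξ k : ℂˣ) : ℂ) • v) (conjVec (u - ((ξ k : ℂˣ) : ℂ) • v)) = 0 := by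
    intro k
    obtain ⟨p, hp, hL⟩ := linearPoint_surjective (L k)
    obtain ⟨hne, hk⟩ := smul_rootTriple α ξ k
    have h1 := hφ k
    rw [Function.Embedding.trans_apply, ← hL, complexify_linearPoint, hk,
      linearPoint_eq_iff] at h1
    obtain ⟨t, ht⟩ := exists_eq_smul_of_det2_eq_zero (ofRealVec_ne_zero hp) h1
    rw [ht, conjVec_smul, conjVec_ofRealVec, det2_smul_left, det2_smul_right, det2_self,
      mul_zero, mul_zero]
  obtain ⟨t, ht, hvt, hD⟩ := exists_eq_smul_conjVec (det2_columns_ne_zero α)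
    (η := fun k => ((ξ k : ℂˣ) : ℂ))
    (fun k l h => ξ.injective (Subtype.ext (Units.ext h))) (fun k => norm_rootsOfUnity hd0 _) hreal
  change v = t • conjVec u at hvt
  obtain ⟨ε, hε, hεd⟩ := exists_norm_eq_one_pow_eq_neg_one (d := d) (by omega)
  have ht0 : t ≠ 0 := by
    rintro rfl
    simp at ht
  -- The scalar `μ` must make `(μ u) ^ d + (μ̄ ū) ^ d` proportional to `u ^ d - t ^ d ū ^ d`. As `μ̄
  -- / μ = μ⁻² = t / ε`, its `d`-th power is `-t ^ d`.
  obtain ⟨μ, hμ⟩ := IsAlgClosed.exists_pow_nat_eq (ε / t) two_pos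
  have hμn : ‖μ‖ = 1 := by
    have := congrArg norm hμ
    rw [norm_pow, norm_div, hε, ht, div_one] at this
    exact (pow_eq_one_iff_of_nonneg (norm_nonneg _) two_ne_zero).1 this
  have hμ0 : μ ≠ 0 := by
    rintro rfl
    simp at hμn
  have hμc : μ * starRingEnd ℂ μ = 1 := by
    rw [Complex.mul_conj, Complex.normSq_eq_norm_sq, hμn]
    simp
  have hpow : starRingEnd ℂ μ ^ d = -(μ ^ d * t ^ d) := by
    apply mul_left_cancel₀ (pow_ne_zero d hμ0)
    rw [← mul_pow, hμc, one_pow]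
    have : (μ ^ 2 * t) ^ d = -1 := by rw [hμ, div_mul_cancel₀ _ ht0, hεd]
    rw [mul_pow, ← pow_mul, mul_comm 2 d, pow_mul] at this
    linear_combination this
  obtain ⟨f, hf⟩ := exists_conjPair d (μ • u)
  have hpair : IsConjPair f := by
    refine ⟨μ • u, ?_, hf⟩
    rw [conjVec_smul, det2_smul_left, det2_smul_right, ← mul_assoc, hμc, one_mul]
    exact hD
  have hf0 := hpair.ne_zero (by omega)
  refine ⟨Projectivization.mk ℝ f hf0, (mk_mem_maximalGapSet_iff hd hf0).2 hpair, ?_⟩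
  rw [complexify_mk, Projectivization.mk_eq_mk_iff']
  refine ⟨μ ^ d, Subtype.ext ?_⟩
  rw [hf, Submodule.coe_smul, coe_smul_powSub, ← hu, ← hv, hvt, conjVec_smul]
  simp only [linearPoly_smul, mul_pow, MvPolynomial.smul_eq_C_mul, ← map_pow, hpow, map_neg,
    map_mul]
  ring

/-- The matrix with columns `u` and `ε ū` sends `x ^ d - y ^ d` to `u ^ d + ū ^ d` and every `[x - ζ
y]` with `|ζ| = 1` to a real point, so any three roots of unity will do. -/
lemma mem_iUnion_Gamma (hd : 4 ≤ d) (hd0 : d ≠ 0) {f : Form ℝ d} (hf0 : f ≠ 0)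
    (hf : IsConjPair f) : ∃ (L : Fin 3 ↪ ℙ ℝ (Form ℝ 1)) (ξ : Fin 3 ↪ rootsOfUnity d ℂ),
      Gamma d hd0 (L.trans (complexify 1)) ξ = complexify d (Projectivization.mk ℝ f hf0) := by
  have : NeZero d := ⟨hd0⟩
  obtain ⟨u, hu, hf⟩ := hf
  obtain ⟨ε, hε, hεd⟩ := exists_norm_eq_one_pow_eq_neg_one (d := d) (by omega)
  obtain ⟨ξ⟩ : Nonempty (Fin 3 ↪ rootsOfUnity d ℂ) := by
    have := Fintype.ofFinite (rootsOfUnity d ℂ)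
    apply Function.Embedding.nonempty_of_card_le
    rw [Fintype.card_fin, Fintype.card_eq_nat_card, Complex.card_rootsOfUnity]
    omega
  have hε0 : ε ≠ 0 := by
    rintro rfl
    simp at hε
  let A : Matrix (Fin 2) (Fin 2) ℂ := Matrix.of fun i j => ![u i, (ε • conjVec u) i] j
  have hA : A.det ≠ 0 := by
    have : A.det = ε * det2 u (conjVec u) := by
      rw [Matrix.det_fin_two]
      simp [A, det2]
      ring
    rw [this]
    exact mul_ne_zero hε0 hu
  let α : GL (Fin 2) ℂ := Matrix.GeneralLinearGroup.mkOfDetNeZero A hA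
  have hα0 : (fun i => α.1 i 0) = u := rfl
  have hα1 : (fun i => α.1 i 1) = ε • conjVec u := rfl
  have hL : ∀ k, ∃ l : ℙ ℝ (Form ℝ 1),
      complexify 1 l = (Matrix.ProjGenLinGroup.mk α : PGL(2, ℂ)) • rootTriple ξ k := by
    intro k
    obtain ⟨hne, hk⟩ := smul_rootTriple α ξ k
    have hnorm : ‖((ξ k : ℂˣ) : ℂ) * ε‖ = 1 := by
      rw [norm_mul, norm_rootsOfUnity hd0, hε, one_mul]
    obtain ⟨κ, p, hp⟩ := exists_sub_smul_conjVec_eq hnorm u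
    have hne' := hne
    rw [hα0, hα1, smul_smul, hp] at hne'
    have hp0 : p ≠ 0 := by
      rintro rfl
      apply hne'
      ext
      simp [ofRealVec]
    refine ⟨linearPoint p hp0, ?_⟩
    rw [complexify_linearPoint, hk, linearPoint_eq_iff]
    change det2 _ _ = 0
    rw [hα0, hα1, smul_smul, hp, det2_smul_right, det2_self, mul_zero]
  choose l hl using hL
  let L : Fin 3 ↪ ℙ ℝ (Form ℝ 1) := ⟨l, fun j k hjk => by
    have := congrArg (complexify 1) hjk
    rw [hl, hl] at this
    exact (rootTriple ξ).injective (MulAction.injective _ this)⟩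
  refine ⟨L, ξ, ?_⟩
  rw [Gamma_eq (φ := Matrix.ProjGenLinGroup.mk α) fun k => (hl k).symm, mk_smul_mk,
    complexify_mk]
  congr 1
  ext1
  rw [coe_smul_powSub, hα0, hα1, hf, linearPoly_smul, mul_pow, ← map_pow, hεd]
  simp

end GammaImage

end BinaryForm

theorem mainTheorem4 (d : ℕ) (hd : 4 ≤ d) :
    IsGreatest (Set.range (BinaryForm.rankGap (d := d))) ((d : ℤ) - 2) ∧
    BinaryForm.complexify d '' BinaryForm.maximalGapSet d =
      ⋃ L : Fin 3 ↪ ℙ ℝ (BinaryForm.Form ℝ 1),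
        Set.range
          (BinaryForm.Gamma d (Nat.ne_zero_of_lt hd) (L.trans (BinaryForm.complexify 1))) ∧
    BinaryForm.maximalGapSet d =
      {F : ℙ ℝ (BinaryForm.Form ℝ d) |
        BinaryForm.waringRank (BinaryForm.complexify d F) = 2 ∧ BinaryForm.IsHyperbolic F} := by
  refine ⟨BinaryForm.isGreatest_range_rankGap hd, ?_, ?_⟩
  · apply Set.Subset.antisymm
    · rintro _ ⟨F, hF, rfl⟩
      induction F using Projectivization.ind with | h f hf =>
      obtain ⟨L, ξ, h⟩ := BinaryForm.mem_iUnion_Gamma hd (Nat.ne_zero_of_lt hd) hf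
        ((BinaryForm.mk_mem_maximalGapSet_iff hd hf).1 hF)
      exact Set.mem_iUnion.2 ⟨L, ξ, h⟩
    · refine Set.iUnion_subset fun L => ?_
      rintro _ ⟨ξ, rfl⟩
      exact BinaryForm.Gamma_mem_image hd _ L ξ
  · ext F
    induction F using Projectivization.ind with | h f hf =>
    exact (BinaryForm.mk_mem_maximalGapSet_iff hd hf).trans (BinaryForm.isConjPair_iff hd hf)
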